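/- **Setting.** Let $K$ be a compact connected metric space and $F_0,\dots,F_{N-1}:K\to K$ ($N\ge 3$) injective contractions with $K=\bigcup_i F_iK$. For a word $w=w_1\cdots w_m$ put $F_w=F_{w_1}\circ\cdots\circ F_{w_m}$. Let $V_0=\{q_0,q_1,q_2\}\subset K$ consist of three distinct points with $F_lq_l=q_l$, such that $F_wK\cap F_{w'}K\subset F_wV_0\cap F_{w'}V_0$ for different words $w,w'$ of the same length, and such that no $q_l$ lies in two different cells $F_iK,F_jK$. Put $V_m=\bigcup_{|w|=m}F_wV_0$ and $V_*=\bigcup_m V_m$. Let $0<r_i<1$ and $$\mathcal E_0(f,g)=\sum_{0\le i<j\le 2}(f(q_i)-f(q_j))(g(q_i)-g(q_j)),\qquad \mathcal E_{m+1}(f,g)=\sum_i r_i^{-1}\mathcal E_m(f\circ F_i,g\circ F_i),$$ and assume that for every $m$ and $f$ the minimum of $\mathcal E_{m+1}(f',f')$ over all $f'$ with $f'|_{V_m}=f|_{V_m}$ is $\mathcal E_m(f,f)$. Put $\mathcal E(f,g)=\lim_m\mathcal E_m(f,g)$; $\mathrm{dom}\,\mathcal E$ is the set of continuous $f$ with $\mathcal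 E(f,f)<\infty$. Let $\mu$ be the self-similar probability measure $\mu=\sum_i\mu_i\,\mu\circ F_i^{-1}$ with weights $\mu_i>0$, $\sum_i\mu_i=1$, and assume that $r_i\mu_i$ is independent of $i$. Assume $D3$ symmetry: every permutation $\sigma$ of $\{0,1,2\}$ is realized by a homeomorphism $\hat\sigma$ of $K$, with $\widehat{\sigma\tau}=\hat\sigma\hat\tau$, $\hat\sigma q_l=q_{\sigma l}$, $\hat\sigma F_l=F_{\sigma l}\hat\sigma$ ($l=0,1,2$), and all $\mathcal E_m$ and $\mu$ are invariant under $\hat\sigma$. Write $R_i$ for the rotation $q_l\mapsto q_{l+i}$ and $g_l$ for the reflection that fixes $q_l$ and interchanges the other two boundary points (indices modulo 3). Let $\mathcal H_0$ be the space of harmonic functions, i.e. continuous $h$ with $\mathcal E_{m+1}(h,h)=\mathcal E_m(h,h)$ for all $m$, and assume that the maps $M_l:\mathcal H_0\to\mathcal H_0$, $M_lh=h\circ F_l$ ($l=0,1,2$), are nondegenerate. Put $r=r_0$ $(=r_1=r_2)$ and let $\lambda$ be the third eigenvalue of $M_l$, besides $1$ and $r$; that is, $\lambda=\operatorname{tr}M_0-1-r$.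 For $f\in\mathrm{dom}\,\mathcal E$ and $u$ continuous, $\Delta f=u$ means $\mathcal E(f,v)=-\int_K uv\,d\mu$ for all $v\in\mathrm{dom}\,\mathcal E$ with $v|_{V_0}=0$. Let $\mathcal H_n$ be the set of $f$ with $\Delta^{n+1}f=0$. Let $x\in V_*\setminus V_0$, let $m_0$ be the least $m$ with $x\in V_m$, let $W(x)$ be the set of words $w$ of length $m_0$ such that $x=F_wq_l$ for some (unique) $l=l_w$, and let $U(x)=\bigcup_{w\in W(x)}F_wK$. Assume that the cells $F_wK$, $w\in W(x)$, meet pairwise only at $x$. Write $r_w,\mu_w$ for the products of the $r_{w_i}$, $\mu_{w_i}$. For $h$ on $U(x)$, $\Delta^ih=u$ means $\Delta^i(h\circ F_w)=(r_w\mu_w)^i\,u\circ F_w$ for all $w\in W(x)$. For $w\in W(x)$ and $l=l_w$ let $$\partial_n^wh(x)=\lim_{m\to\infty}r_w^{-1}r^{-m}\bigl(2h(x)-h(F_wF_l^mq_{l+1})-h(F_wF_l^mq_{l-1})\bigr),$$ $$\partial_T^wh(x)=\lim_{m\to\infty}r_w^{-1}\lambda^{-m}\bigl(h(F_wF_l^mq_{l+1})-h(F_wF_l^mq_{l-1})\bigr).$$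 Let $\mathcal H_n(U(x))$ be the space of functions $h$ on $U(x)$ with $h\circ F_w\in\mathcal H_n$ for all $w\in W(x)$ such that for $0\le i\le n$ the function $\Delta^ih$ is well defined on $U(x)$ (its values at $x$ from the different cells agree) and $\sum_{w\in W(x)}\partial_n^w\Delta^ih(x)=0$. **Theorem.** Let $n\ge 0$ and let $x$ be as above. 1. There is a unique map $g_x:U(x)\to U(x)$ with $g_x\circ F_w=F_w\circ g_{l_w}$ for all $w\in W(x)$. 2. There is a unique linear map $R:\mathcal H_n(U(x))\to\mathcal H_n(U(x))$ such that for all $w\in W(x)$ and $y\in F_wK$ $$R(h)(y)=\Bigl(\sum_{w'\in W(x)}r_{w'}^{-1}\Bigr)^{-1}\sum_{w'\in W(x)}r_{w'}^{-1}\,h\circ F_{w'}\circ R_{l_{w'}-l_w}\circ F_w^{-1}(y).$$ 3. For each $k=1,2,3$ there is a unique linear projection $P_k$ of $\mathcal H_n(U(x))$ into itself such that for all $h\in\mathcal H_n(U(x))$, $w\in W(x)$ and $0\le i\le n$ (all the derivatives existing) $$\Delta^iP_k(h)(x)=\delta_{k1}\Delta^ih(x),\quad \partial_n^w\Delta^iP_k(h)(x)=\delta_{k2}\,\partial_n^w\Delta^ih(x),\quad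 \partial_T^w\Delta^iP_k(h)(x)=\delta_{k3}\,\partial_T^w\Delta^ih(x).$$ 4. For every $h\in\mathcal H_n(U(x))$, $$P_1(h)=\tfrac12\bigl(R(h)\circ g_x+R(h)\bigr),$$ $$P_2(h)=\tfrac12\bigl(h+h\circ g_x-R(h)\circ g_x-R(h)\bigr),$$ $$P_3(h)=\tfrac12\bigl(h-h\circ g_x\bigr).$$ -/

import Mathlib

open Filter Topology MeasureTheory

/-- `F_w = F_{w₁} ∘ ⋯ ∘ F_{w_m}` for a word `w = w₁ ⋯ w_m`. -/
def wordMap {ι K : Type*} (F : ι → K → K) (w : List ι) : K → K :=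
  w.foldr (fun i g => F i ∘ g) id

/-- A post critically finite self-similar structure on a compact connected metric space `K`, with
`N` contractive injections and a boundary `V₀ = {q 0, q 1, q 2}` of three points, the point `q l`
being the fixed point of the `l`-th map. -/
structure PCFStructure (K : Type*) [MetricSpace K] [CompactSpace K] [ConnectedSpace K] where
  N : ℕ
  three_le : 3 ≤ N
  F : Fin N → K → K
  F_injective : ∀ i, Function.Injective (F i)
  F_contracting : ∃ c : NNReal, ∀ i, ContractingWith c (F i)
  F_cover : ∀ y, ∃ i z, F i z = y
  q : Fin 3 → K
  q_injective : Function.Injective q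
  F_q : ∀ l : Fin 3, F (Fin.castLE three_le l) (q l) = q l
  /-- Two different cells of the same level meet only in boundary points of both. -/
  cell_inter : ∀ w w' : List (Fin N), w.length = w'.length → w ≠ w' →
    Set.range (wordMap F w) ∩ Set.range (wordMap F w') ⊆
      (wordMap F w) '' Set.range q ∩
        (wordMap F w') '' Set.range q
  /-- The boundary points of `K` are not points where two different cells meet. -/
  q_not_mem : ∀ (l : Fin 3) (i j : Fin N), i ≠ j → q l ∉ Set.range (F i) ∩ Set.range (F j)

namespace PCFStructure

variable {K : Type*} [MetricSpace K] [CompactSpace K] [ConnectedSpace K] (S : PCFStructure K)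

/-- The index of the map that fixes the boundary point `q l`. -/
def bd (l : Fin 3) : Fin S.N := Fin.castLE S.three_le l

/-- `F_w = F_{w₁} ∘ ⋯ ∘ F_{w_m}`. -/
def Fw (w : List (Fin S.N)) : K → K := wordMap S.F w

/-- The vertices of level `m`. -/
def V (m : ℕ) : Set K := {y | ∃ w : List (Fin S.N), w.length = m ∧ ∃ l, S.Fw w (S.q l) = y}

/-- All vertices. -/
def Vstar : Set K := ⋃ m, S.V m

/-- The graph energies: `E₀` is the energy of the complete graph on `V₀` with unit conductances,
and `E_{m+1}(f, g) = ∑ i, r_i⁻¹ E_m(f ∘ F_i, g ∘ F_i)`. -/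
noncomputable def E (r : Fin S.N → ℝ) : ℕ → (K → ℝ) → (K → ℝ) → ℝ
  | 0, f, g => ∑ p ∈ ({(0, 1), (1, 2), (2, 0)} : Finset (Fin 3 × Fin 3)),
      (f (S.q p.1) - f (S.q p.2)) * (g (S.q p.1) - g (S.q p.2))
  | m + 1, f, g => ∑ i, (r i)⁻¹ * E r m (f ∘ S.F i) (g ∘ S.F i)

/-- The first `m` with `x ∈ V_m`. -/
noncomputable def level (x : K) : ℕ := sInf {m | x ∈ S.V m}

open Classical in
/-- `W(x)`: the words `w` of length `level x` such that `x = F_w q_l` for some `l`. -/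
noncomputable def W (x : K) : Finset (List (Fin S.N)) :=
  (List.finite_length_eq (Fin S.N) (S.level x)).toFinset.filter fun w => ∃ l, S.Fw w (S.q l) = x

open Classical in
theorem exists_idx {x : K} (w : S.W x) : ∃ l, S.Fw w.1 (S.q l) = x :=
  (Finset.mem_filter.1 w.2).2

open Classical in
theorem length_eq {x : K} (w : S.W x) : w.1.length = S.level x := by
  simpa using (Finset.mem_filter.1 w.2).1

/-- The (unique) `l` with `x = F_w q_l`. -/
noncomputable def idx {x : K} (w : S.W x) : Fin 3 := (S.exists_idx w).choose

/-- `U(x)`: the union of the cells of level `level x` that contain `x`. -/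
def U (x : K) : Set K :=
  ⋃ w ∈ {w : List (Fin S.N) | w.length = S.level x ∧ x ∈ Set.range (S.Fw w)}, Set.range (S.Fw w)

theorem exists_word (m : ℕ) (x : K) : ∃ w : List (Fin S.N), w.length = m ∧ x ∈ Set.range (S.Fw w) := by
  induction m generalizing x with
  | zero => exact ⟨[], rfl, x, rfl⟩
  | succ m ih =>
    obtain ⟨i, z, rfl⟩ := S.F_cover x
    obtain ⟨w, hw, y, rfl⟩ := ih z
    exact ⟨i :: w, by simp [hw], y, rfl⟩

/-- `x` as a point of `U(x)`. -/
def center (x : K) : S.U x := ⟨x, by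
  obtain ⟨w, hw, hx⟩ := S.exists_word (S.level x) x
  exact Set.mem_biUnion (show w ∈ {w | _} from ⟨hw, hx⟩) hx⟩

/-- `F_w`, for `w ∈ W(x)`, as a map of `K` into `U(x)`. -/
def toU {x : K} (w : S.W x) (y : K) : S.U x := ⟨S.Fw w.1 y, by
  obtain ⟨l, hl⟩ := S.exists_idx w
  exact Set.mem_biUnion (show w.1 ∈ {w | _} from ⟨S.length_eq w, ⟨_, hl⟩⟩) ⟨y, rfl⟩⟩

end PCFStructure

/-- A `D3` symmetric fractal: a p.c.f. self-similar structure with three boundary points, a regular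
harmonic structure with unit conductances on `V₀`, and a self-similar measure `μ`, such that
`r_i μ_i` does not depend on `i` and all of these are invariant under an action of the
permutations of the boundary. -/
structure D3Fractal (K : Type*) [MetricSpace K] [CompactSpace K] [ConnectedSpace K]
    [MeasurableSpace K] [BorelSpace K] extends PCFStructure K where
  /-- The renormalization factors. -/
  r : Fin N → ℝ
  r_pos : ∀ i, 0 < r i
  r_lt_one : ∀ i, r i < 1
  /-- The restriction of the energy of level `m + 1` to `V_m` is the energy of level `m`. -/
  E_restrict : ∀ (m : ℕ) (f : K → ℝ),
    IsLeast {e | ∃ f' : K → ℝ, (∀ y ∈ toPCFStructure.V m, f' y = f y) ∧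
      toPCFStructure.E r (m + 1) f' f' = e} (toPCFStructure.E r m f f)
  /-- The probability weights of the self-similar measure. -/
  wt : Fin N → ℝ
  wt_pos : ∀ i, 0 < wt i
  wt_sum : ∑ i, wt i = 1
  μ : Measure K
  μ_prob : IsProbabilityMeasure μ
  μ_selfSimilar : ∀ A, MeasurableSet A → μ A = ∑ i, ENNReal.ofReal (wt i) * μ (F i ⁻¹' A)
  r_mul_wt : ∀ i j, r i * wt i = r j * wt j
  /-- The symmetries of `K`. -/
  sym : Equiv.Perm (Fin 3) →* (K ≃ₜ K)
  sym_q : ∀ σ l, sym σ (q l) = q (σ l)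
  /-- The symmetries permute the maps that fix the boundary points. -/
  sym_F : ∀ σ l y, sym σ (F (Fin.castLE three_le l) y) = F (Fin.castLE three_le (σ l)) (sym σ y)
  sym_E : ∀ σ m f, toPCFStructure.E r m (f ∘ sym σ) (f ∘ sym σ) = toPCFStructure.E r m f f
  sym_μ : ∀ σ, μ.map (sym σ) = μ

namespace D3Fractal

variable {K : Type*} [MetricSpace K] [CompactSpace K] [ConnectedSpace K]
  [MeasurableSpace K] [BorelSpace K] (S : D3Fractal K)

/-- The energy form of level `m`. -/
noncomputable abbrev En (m : ℕ) (f g : K → ℝ) : ℝ := S.E S.r m f g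

theorem En_symm (m : ℕ) (f g : K → ℝ) : S.En m f g = S.En m g f := by
  induction m generalizing f g with
  | zero => simp only [PCFStructure.E, mul_comm]
  | succ m ih => simp only [PCFStructure.E]; simp only [ih (f ∘ _)]

theorem En_add_left (m : ℕ) (f f' g : K → ℝ) :
    S.En m (f + f') g = S.En m f g + S.En m f' g := by
  induction m generalizing f f' g with
  | zero =>
    simp only [PCFStructure.E, ← Finset.sum_add_distrib, Pi.add_apply]
    exact Finset.sum_congr rfl fun _ _ => by ring
  | succ m ih =>
    simp only [PCFStructure.E, ← Finset.sum_add_distrib]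
    refine Finset.sum_congr rfl fun i _ => ?_
    rw [← mul_add, ← ih]; rfl

theorem En_smul_left (m : ℕ) (c : ℝ) (f g : K → ℝ) :
    S.En m (c • f) g = c * S.En m f g := by
  induction m generalizing f g with
  | zero =>
    simp only [PCFStructure.E, Finset.mul_sum, Pi.smul_apply, smul_eq_mul]
    exact Finset.sum_congr rfl fun _ _ => by ring
  | succ m ih =>
    simp only [PCFStructure.E, Finset.mul_sum]
    refine Finset.sum_congr rfl fun i _ => ?_
    rw [mul_left_comm, ← ih]; rfl

theorem En_nonneg (m : ℕ) (f : K → ℝ) : 0 ≤ S.En m f f := by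
  induction m generalizing f with
  | zero => exact Finset.sum_nonneg fun _ _ => mul_self_nonneg _
  | succ m ih =>
    exact Finset.sum_nonneg fun i _ => mul_nonneg (inv_nonneg.2 (S.r_pos i).le) (ih _)

theorem En_mono (m : ℕ) (f : K → ℝ) : S.En m f f ≤ S.En (m + 1) f f :=
  (S.E_restrict m f).2 ⟨f, fun _ _ => rfl, rfl⟩

theorem En_parallelogram (m : ℕ) (f g : K → ℝ) :
    S.En m (f + g) (f + g) + S.En m (f + (-1 : ℝ) • g) (f + (-1 : ℝ) • g) =
      2 * S.En m f f + 2 * S.En m g g := by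
  have key : ∀ a b : K → ℝ, S.En m (a + b) (a + b) =
      S.En m a a + 2 * S.En m a b + S.En m b b := by
    intro a b
    rw [En_add_left, En_symm S m a (a + b), En_symm S m b (a + b), En_add_left, En_add_left,
      En_symm S m b a]
    ring
  rw [key, key, En_smul_left, En_symm S m f ((-1 : ℝ) • g), En_smul_left,
    En_symm S m g ((-1 : ℝ) • g), En_smul_left, En_symm S m g f]
  ring

/-- `H₀`, the harmonic functions: those minimizing the energy from each level to the next. -/
def harmonic : Submodule ℝ C(K, ℝ) where
  carrier := {h | ∀ m, S.En (m + 1) h h = S.En m h h}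
  zero_mem' m := by
    have h0 : ((0 : C(K, ℝ)) : K → ℝ) = (0 : ℝ) • (0 : K → ℝ) := by ext; simp
    rw [h0, En_smul_left, En_smul_left, zero_mul, zero_mul]
  add_mem' {f g} hf hg m := by
    have h1 := S.En_parallelogram m f g
    have h2 := S.En_parallelogram (m + 1) f g
    have h3 := S.En_mono m (f + g)
    have h4 := S.En_mono m (f + (-1 : ℝ) • g)
    have hf := hf m
    have hg := hg m
    rw [ContinuousMap.coe_add]
    linarith
  smul_mem' c f hf m := by
    have hf := hf m
    rw [ContinuousMap.coe_smul, En_smul_left, En_smul_left, En_symm, En_smul_left,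
      En_symm S m, En_smul_left, hf]

theorem continuous_F (i : Fin S.N) : Continuous (S.F i) :=
  (S.F_contracting.choose_spec i).toLipschitzWith.continuous

/-- The harmonic extension map `h ↦ h ∘ F_l` of `H₀` into itself, for `l = 0, 1, 2`. -/
def M (l : Fin 3) : S.harmonic →ₗ[ℝ] S.harmonic where
  toFun h := ⟨h.1.comp ⟨S.F (S.bd l), S.continuous_F _⟩, fun m => by
    have hs : S.En (m + 1 + 1) h.1 h.1 = S.En (m + 1) h.1 h.1 := h.2 (m + 1)
    simp only [En] at hs
    rw [PCFStructure.E, PCFStructure.E] at hs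
    have hle : ∀ i ∈ Finset.univ, (S.r i)⁻¹ * S.E S.r m (h.1 ∘ S.F i) (h.1 ∘ S.F i) ≤
        (S.r i)⁻¹ * S.E S.r (m + 1) (h.1 ∘ S.F i) (h.1 ∘ S.F i) := fun i _ =>
      mul_le_mul_of_nonneg_left (S.En_mono m _) (inv_nonneg.2 (S.r_pos i).le)
    have := (Finset.sum_eq_sum_iff_of_le hle).1 hs.symm (S.bd l) (Finset.mem_univ _)
    exact (mul_left_cancel₀ (inv_ne_zero (S.r_pos _).ne') this).symm⟩
  map_add' _ _ := rfl
  map_smul' _ _ := rfl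

/-- `r = r₀ = r₁ = r₂`. -/
def rb : ℝ := S.r (S.bd 0)

/-- The third eigenvalue `λ` of the harmonic extension maps, whose other two eigenvalues are
`1` and `r`. -/
noncomputable def lam : ℝ := LinearMap.trace ℝ S.harmonic (S.M 0) - 1 - S.rb

/-- `r_w`. -/
def rWord (w : List (Fin S.N)) : ℝ := (w.map S.r).prod

/-- `μ_w`. -/
def wtWord (w : List (Fin S.N)) : ℝ := (w.map S.wt).prod

/-- The domain of the energy `E(f) = lim E_m(f)`. -/
def DomE (f : K → ℝ) : Prop := Continuous f ∧ BddAbove (Set.range fun m => S.En m f f)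

/-- `f` is in the domain of the Laplacian and `Δ f = u`, in the weak formulation:
`E(f, v) = -∫ u v dμ` for all `v` of finite energy that vanish on the boundary. -/
def IsLap (f u : K → ℝ) : Prop :=
  S.DomE f ∧ Continuous u ∧ ∀ v, S.DomE v → (∀ l, v (S.q l) = 0) →
    Tendsto (fun m => S.En m f v) atTop (𝓝 (-∫ y, u y * v y ∂S.μ))

/-- `Δ^i f = u` on `K`. -/
def IsIterLap : ℕ → (K → ℝ) → (K → ℝ) → Prop
  | 0, f, u => u = f
  | i + 1, f, u => ∃ v, S.IsLap f v ∧ IsIterLap i v u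

/-- `f ∈ H_n`, that is, `Δ^(n+1) f = 0` on `K`. -/
def IsMultiharmonic (n : ℕ) (f : K → ℝ) : Prop := S.IsIterLap (n + 1) f 0

variable {x : K}

/-- `Δ^i h = u` on `U(x)`: on each cell `F_w K` of `U(x)` one has
`Δ^i (h ∘ F_w) = (r_w μ_w)^i (Δ^i h) ∘ F_w`. -/
def IsLocalIterLap (i : ℕ) (h u : S.U x → ℝ) : Prop :=
  ∀ w : S.W x, S.IsIterLap i (h ∘ S.toU w) ((S.rWord w.1 * S.wtWord w.1) ^ i • (u ∘ S.toU w))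

/-- `∂_n^w h (x) = d`, the limit being required to exist. -/
def HasNormalDeriv (w : S.W x) (h : S.U x → ℝ) (d : ℝ) : Prop :=
  Tendsto (fun m : ℕ => (S.rWord w.1)⁻¹ * (S.rb ^ m)⁻¹ * (2 * h (S.center x)
      - h (S.toU w ((S.F (S.bd (S.idx w)))^[m] (S.q (S.idx w + 1))))
      - h (S.toU w ((S.F (S.bd (S.idx w)))^[m] (S.q (S.idx w - 1)))))) atTop (𝓝 d)

/-- `∂_T^w h (x) = d`, the limit being required to exist. -/
def HasTransverseDeriv (w : S.W x) (h : S.U x → ℝ) (d : ℝ) : Prop :=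
  Tendsto (fun m : ℕ => (S.rWord w.1)⁻¹ * (S.lam ^ m)⁻¹ *
      (h (S.toU w ((S.F (S.bd (S.idx w)))^[m] (S.q (S.idx w + 1))))
      - h (S.toU w ((S.F (S.bd (S.idx w)))^[m] (S.q (S.idx w - 1)))))) atTop (𝓝 d)

/-- The matching condition at `x`: the normal derivatives at `x` exist and their sum vanishes. -/
def Matching (h : S.U x → ℝ) : Prop :=
  ∃ d : S.W x → ℝ, (∀ w, S.HasNormalDeriv w h (d w)) ∧ ∑ w, d w = 0

theorem DomE.add {S : D3Fractal K} {f g : K → ℝ} (hf : S.DomE f) (hg : S.DomE g) :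
    S.DomE (f + g) := by
  refine ⟨hf.1.add hg.1, ?_⟩
  obtain ⟨a, ha⟩ := hf.2
  obtain ⟨b, hb⟩ := hg.2
  refine ⟨2 * a + 2 * b, ?_⟩
  rintro _ ⟨m, rfl⟩
  have h1 : S.En m f f ≤ a := ha ⟨m, rfl⟩
  have h2 : S.En m g g ≤ b := hb ⟨m, rfl⟩
  have h3 := S.En_parallelogram m f g
  have h4 := S.En_nonneg m (f + (-1 : ℝ) • g)
  change S.En m (f + g) (f + g) ≤ _
  linarith

theorem DomE.smul {S : D3Fractal K} {f : K → ℝ} (hf : S.DomE f) (c : ℝ) :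
    S.DomE (c • f) := by
  refine ⟨hf.1.const_smul c, ?_⟩
  obtain ⟨a, ha⟩ := hf.2
  refine ⟨c * c * a, ?_⟩
  rintro _ ⟨m, rfl⟩
  have h1 : S.En m f f ≤ a := ha ⟨m, rfl⟩
  change S.En m (c • f) (c • f) ≤ _
  rw [En_smul_left, En_symm, En_smul_left, ← mul_assoc]
  exact mul_le_mul_of_nonneg_left h1 (mul_self_nonneg c)

theorem integrable_mul {u v : K → ℝ} (hu : Continuous u) (hv : Continuous v) :
    Integrable (fun y => u y * v y) S.μ :=
  haveI := S.μ_prob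
  (hu.mul hv).integrable_of_hasCompactSupport (HasCompactSupport.of_compactSpace _)

theorem IsLap.add {S : D3Fractal K} {f f' u u' : K → ℝ} (h : S.IsLap f u) (h' : S.IsLap f' u') :
    S.IsLap (f + f') (u + u') := by
  refine ⟨h.1.add h'.1, h.2.1.add h'.2.1, fun v hv hv0 => ?_⟩
  have := (h.2.2 v hv hv0).add (h'.2.2 v hv hv0)
  simp only [En_add_left, Pi.add_apply, add_mul]
  rwa [integral_add (S.integrable_mul h.2.1 hv.1) (S.integrable_mul h'.2.1 hv.1), neg_add]

theorem IsLap.smul {S : D3Fractal K} {f u : K → ℝ} (h : S.IsLap f u) (c : ℝ) :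
    S.IsLap (c • f) (c • u) := by
  refine ⟨h.1.smul c, h.2.1.const_smul c, fun v hv hv0 => ?_⟩
  have := (h.2.2 v hv hv0).const_mul c
  simp only [En_smul_left, Pi.smul_apply, smul_eq_mul, mul_assoc]
  rwa [integral_const_mul, ← mul_neg]

theorem IsIterLap.add {S : D3Fractal K} {i : ℕ} {f f' u u' : K → ℝ} (h : S.IsIterLap i f u)
    (h' : S.IsIterLap i f' u') : S.IsIterLap i (f + f') (u + u') := by
  induction i generalizing f f' with
  | zero => exact congrArg₂ (· + ·) h h'
  | succ i ih =>
    obtain ⟨v, hv, hvu⟩ := h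
    obtain ⟨v', hv', hvu'⟩ := h'
    exact ⟨v + v', hv.add hv', ih hvu hvu'⟩

theorem IsIterLap.smul {S : D3Fractal K} {i : ℕ} {f u : K → ℝ} (h : S.IsIterLap i f u) (c : ℝ) :
    S.IsIterLap i (c • f) (c • u) := by
  induction i generalizing f with
  | zero => exact congrArg (c • ·) h
  | succ i ih =>
    obtain ⟨v, hv, hvu⟩ := h
    exact ⟨c • v, hv.smul c, ih hvu⟩

theorem IsIterLap.zero (i : ℕ) : S.IsIterLap i 0 0 := by
  have hl : S.IsLap 0 0 := by
    have hE : ∀ m g, S.En m 0 g = 0 := fun m g => by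
      have := S.En_smul_left m 0 0 g
      rwa [smul_zero, zero_mul] at this
    refine ⟨⟨continuous_zero, 0, ?_⟩, continuous_zero, fun v _ _ => ?_⟩
    · rintro _ ⟨m, rfl⟩
      exact (hE m 0).le
    · simp [hE]
  induction i with
  | zero => rfl
  | succ i ih => exact ⟨0, hl, ih⟩

theorem IsLocalIterLap.add {S : D3Fractal K} {i : ℕ} {h h' u u' : S.U x → ℝ}
    (H : S.IsLocalIterLap i h u) (H' : S.IsLocalIterLap i h' u') :
    S.IsLocalIterLap i (h + h') (u + u') := fun w => by
  have := (H w).add (H' w)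
  rwa [← smul_add] at this

theorem IsLocalIterLap.smul {S : D3Fractal K} {i : ℕ} {h u : S.U x → ℝ}
    (H : S.IsLocalIterLap i h u) (c : ℝ) : S.IsLocalIterLap i (c • h) (c • u) := fun w => by
  have := (H w).smul c
  rwa [smul_comm] at this

theorem Matching.add {S : D3Fractal K} {h h' : S.U x → ℝ} (H : S.Matching h)
    (H' : S.Matching h') : S.Matching (h + h') := by
  obtain ⟨d, hd, hs⟩ := H
  obtain ⟨d', hd', hs'⟩ := H'
  refine ⟨d + d', fun w => ((hd w).add (hd' w)).congr fun m => ?_, ?_⟩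
  · simp only [Pi.add_apply]; ring
  · simp only [Pi.add_apply, Finset.sum_add_distrib, hs, hs', add_zero]

theorem Matching.smul {S : D3Fractal K} {h : S.U x → ℝ} (H : S.Matching h) (c : ℝ) :
    S.Matching (c • h) := by
  obtain ⟨d, hd, hs⟩ := H
  refine ⟨c • d, fun w => ((hd w).const_mul c).congr fun m => ?_, ?_⟩
  · simp only [Pi.smul_apply, smul_eq_mul]; ring
  · simp only [Pi.smul_apply, smul_eq_mul, ← Finset.mul_sum, hs, mul_zero]

/-- `H_n(U(x))`, the local `(n+1)`-harmonic functions: functions `h` on `U(x)` with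
`h ∘ F_w ∈ H_n` for all `w ∈ W(x)`, for which each `Δ^i h` with `i ≤ n` is a function on `U(x)` (so
that its values at `x` from the different cells agree) and satisfies the matching condition. -/
def localHarmonic (n : ℕ) (x : K) : Submodule ℝ (S.U x → ℝ) where
  carrier := {h | (∀ w : S.W x, S.IsMultiharmonic n (h ∘ S.toU w)) ∧
    ∀ i ≤ n, ∃ u, S.IsLocalIterLap i h u ∧ S.Matching u}
  zero_mem' := by
    refine ⟨fun w => IsIterLap.zero S _, fun i _ => ⟨0, fun w => ?_, 0, fun w => ?_, by simp⟩⟩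
    · have := IsIterLap.zero S i
      have h0 : (S.rWord w.1 * S.wtWord w.1) ^ i • ((0 : S.U x → ℝ) ∘ S.toU w) = 0 := smul_zero _
      rw [h0]; exact this
    · simp [HasNormalDeriv]
  add_mem' {f g} hf hg := by
    refine ⟨fun w => ?_, fun i hi => ?_⟩
    · have := (hf.1 w).add (hg.1 w)
      rwa [add_zero] at this
    · obtain ⟨u, hu, hm⟩ := hf.2 i hi
      obtain ⟨v, hv, hm'⟩ := hg.2 i hi
      exact ⟨u + v, hu.add hv, hm.add hm'⟩
  smul_mem' c f hf := by
    refine ⟨fun w => ?_, fun i hi => ?_⟩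
    · have := (hf.1 w).smul c
      rwa [smul_zero] at this
    · obtain ⟨u, hu, hm⟩ := hf.2 i hi
      exact ⟨c • u, hu.smul c, hm.smul c⟩

/-- `P` is the projection `P_k` (`k = 1, 2, 3`): a linear projection of `H_n(U(x))` into itself
which for all `i ≤ n` and `w ∈ W(x)` keeps the values `Δ^i h (x)` if `k = 1`, the normal derivatives
`∂_n^w Δ^i h (x)` if `k = 2`, the transverse derivatives `∂_T^w Δ^i h (x)` if `k = 3`, and makes
the other two kinds of data zero. -/
def IsMonomialProjection (n : ℕ) (x : K) (k : ℕ)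
    (P : S.localHarmonic n x →ₗ[ℝ] S.localHarmonic n x) : Prop :=
  P ∘ₗ P = P ∧
  ∀ h : S.localHarmonic n x, ∀ i ≤ n, ∃ u v : S.U x → ℝ,
    S.IsLocalIterLap i h u ∧ S.IsLocalIterLap i (P h) v ∧
    v (S.center x) = (if k = 1 then 1 else 0) * u (S.center x) ∧
    ∀ w : S.W x,
      (∃ d, S.HasNormalDeriv w u d ∧ S.HasNormalDeriv w v ((if k = 2 then 1 else 0) * d)) ∧
      (∃ d, S.HasTransverseDeriv w u d ∧
        S.HasTransverseDeriv w v ((if k = 3 then 1 else 0) * d))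

/-- The rotation of `K` with `q_l ↦ q_{l+i}` (cyclically). -/
def rot (i : Fin 3) : K ≃ₜ K := S.sym (Equiv.addRight i)

/-- The reflection of `K` that fixes `q_l` and interchanges the other two boundary points. -/
def refl (l : Fin 3) : K ≃ₜ K := S.sym (Equiv.swap (l + 1) (l - 1))

/-- `R` is the weighted rotation average: for `y = F_w z` with `w ∈ W(x)`,
`R(h)(y) = (∑ r_{w'}⁻¹)⁻¹ ∑ r_{w'}⁻¹ h (F_{w'} (R_{l'-l} z))`, both sums over `w' ∈ W(x)`, where
`x = F_w q_l = F_{w'} q_{l'}`. -/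
def IsRotationAverage (n : ℕ) (x : K)
    (R : S.localHarmonic n x →ₗ[ℝ] S.localHarmonic n x) : Prop :=
  ∀ (h : S.localHarmonic n x) (w : S.W x) (z : K),
    (R h).1 (S.toU w z) = (∑ w' : S.W x, (S.rWord w'.1)⁻¹)⁻¹ *
      ∑ w' : S.W x, (S.rWord w'.1)⁻¹ * h.1 (S.toU w' (S.rot (S.idx w' - S.idx w) z))

/-- `g` is the local symmetry `g_x` of `U(x)`: on each cell `F_w K`, where `x = F_w q_l`, it is the
reflection that fixes `F_w q_l` and interchanges the other two boundary points. -/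
def IsLocalReflection (x : K) (g : S.U x → S.U x) : Prop :=
  ∀ (w : S.W x) (z : K), g (S.toU w z) = S.toU w (S.refl (S.idx w) z)

end D3Fractal

/-! The formulas come from two symmetries. The local reflection `g_x` commutes with `Δ^i`, keeps
values and normal derivatives at `x`, and negates transverse derivatives. The rotation average `R`
keeps values at `x`. Its weights `r_{w'}⁻¹` make each normal derivative of `R h` a multiple of the
sum of all normal derivatives of `h`, which vanishes by the matching condition
(`IsAverage.hasNormalDeriv`). `R` commutes with `Δ^i` because `r_i μ_i` is constant: all cells of
`U(x)` have the same Laplacian scaling factor (`rWord_mul_wtWord`, `IsAverage.isLocalIterLap`).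
Adding up the data, the three right-hand sides keep exactly the values, the normal derivatives and
the transverse derivatives.

What remains is that a function in `H_n(U(x))` is determined by these data. On one cell this is
`eq_zero_of_jet`: by induction on `n` the Laplacian of a function with vanishing jet is zero, so the
function is harmonic. In the coordinates value, flux and transverse difference at `q 0`, the map `M
0` is diagonal with entries `1`, `r`, `λ` (`flux_M`, `transverse_M`), and rotations carry the
resulting scaling laws to every `q l`. Hence the difference quotients of a harmonic function are
constant, and zero limits force zero boundary values. Nondegeneracy gives `λ ≠ 0`. Uniqueness also
yields idempotence.

Transverse derivatives must be shown to exist. The transverse differences of `f` are the values of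
the odd part of `f` along an orbit of `F_l`, and these are combinations of the powers `(λ (r_i
μ_i)^k)^m` (`exists_orbit_expansion`), so dividing by `λ^m` leaves a convergent sequence.

The analytic base is the energy form: oscillation is bounded by energy, which gives continuous
harmonic extensions, and test functions supported on small cells make the weak Laplacian single
valued. -/

namespace PCFStructure

variable {K : Type*} [MetricSpace K] [CompactSpace K] [ConnectedSpace K] (S : PCFStructure K)

/-! ### Cells, vertices and connectedness. -/

theorem F_continuous (i : Fin S.N) : Continuous (S.F i) :=
  (S.F_contracting.choose_spec i).toLipschitzWith.continuous

theorem Fw_nil (y : K) : S.Fw [] y = y := rfl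

theorem Fw_cons (i : Fin S.N) (w : List (Fin S.N)) (y : K) :
    S.Fw (i :: w) y = S.F i (S.Fw w y) := rfl

theorem Fw_append (w w' : List (Fin S.N)) (y : K) :
    S.Fw (w ++ w') y = S.Fw w (S.Fw w' y) := by
  induction w with
  | nil => rfl
  | cons i w ih => rw [List.cons_append, Fw_cons, Fw_cons, ih]

theorem Fw_injective (w : List (Fin S.N)) : Function.Injective (S.Fw w) := by
  induction w with
  | nil => exact Function.injective_id
  | cons i w ih => exact (S.F_injective i).comp ih

theorem Fw_continuous (w : List (Fin S.N)) : Continuous (S.Fw w) := by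
  induction w with
  | nil => exact continuous_id
  | cons i w ih => exact (S.F_continuous i).comp ih

theorem F_bd (l : Fin 3) : S.F (S.bd l) (S.q l) = S.q l := S.F_q l

theorem cell_dist_lt {ε : ℝ} (hε : 0 < ε) :
    ∃ m, ∀ w : List (Fin S.N), w.length = m → ∀ y z, dist (S.Fw w y) (S.Fw w z) < ε := by
  obtain ⟨c, hc⟩ := S.F_contracting
  have hc1 : (c : ℝ) < 1 := (hc (S.bd 0)).1
  have key : ∀ w : List (Fin S.N), ∀ y z,
      dist (S.Fw w y) (S.Fw w z) ≤ c ^ w.length * Metric.diam (Set.univ : Set K) := by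
    intro w y z
    induction w with
    | nil =>
      simpa [Fw_nil] using Metric.dist_le_diam_of_mem isCompact_univ.isBounded (Set.mem_univ y)
        (Set.mem_univ z)
    | cons i w ih =>
      rw [Fw_cons, Fw_cons, List.length_cons, pow_succ', mul_assoc]
      exact ((hc i).toLipschitzWith.dist_le_mul _ _).trans
        (mul_le_mul_of_nonneg_left ih c.2)
  have ht : Tendsto (fun m : ℕ => (c : ℝ) ^ m * Metric.diam (Set.univ : Set K)) atTop (𝓝 0) := by
    simpa using (tendsto_pow_atTop_nhds_zero_of_lt_one c.2 hc1).mul_const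
      (Metric.diam (Set.univ : Set K))
  obtain ⟨m, hm⟩ := (ht.eventually_lt_const hε).exists
  exact ⟨m, fun w hw y z => (key w y z).trans_lt (hw ▸ hm)⟩

theorem q_mem_V (m : ℕ) (l : Fin 3) : S.q l ∈ S.V m := by
  induction m with
  | zero => exact ⟨[], rfl, l, rfl⟩
  | succ m ih =>
    obtain ⟨w, hw, l', h⟩ := ih
    exact ⟨S.bd l :: w, by simp [hw], l', by rw [Fw_cons, h, F_bd]⟩

theorem V_mono_succ (m : ℕ) : S.V m ⊆ S.V (m + 1) := by
  rintro _ ⟨w, hw, l, rfl⟩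
  exact ⟨w ++ [S.bd l], by simp [hw], l, by rw [Fw_append]; exact congrArg _ (S.F_bd l)⟩

theorem V_mono {m m' : ℕ} (h : m ≤ m') : S.V m ⊆ S.V m' :=
  monotone_nat_of_le_succ S.V_mono_succ h

theorem F_mem_V {m : ℕ} {y : K} (hy : y ∈ S.V m) (i : Fin S.N) : S.F i y ∈ S.V (m + 1) := by
  obtain ⟨w, hw, l, rfl⟩ := hy
  exact ⟨i :: w, by simp [hw], l, rfl⟩

theorem Fw_q_mem_Vstar (w : List (Fin S.N)) (l : Fin 3) : S.Fw w (S.q l) ∈ S.Vstar :=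
  Set.mem_iUnion.2 ⟨w.length, w, rfl, l, rfl⟩

theorem mem_Vstar_iff {y : K} : y ∈ S.Vstar ↔ ∃ w l, S.Fw w (S.q l) = y := by
  refine ⟨fun h => ?_, ?_⟩
  · obtain ⟨m, w, -, l, h⟩ := Set.mem_iUnion.1 h
    exact ⟨w, l, h⟩
  · rintro ⟨w, l, rfl⟩
    exact S.Fw_q_mem_Vstar w l

theorem dense_Vstar : Dense S.Vstar := by
  refine Metric.dense_iff.2 fun y ε hε => ?_
  obtain ⟨m, hm⟩ := S.cell_dist_lt hε
  obtain ⟨w, hw, z, rfl⟩ := S.exists_word m y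
  exact ⟨_, hm w hw _ _, S.Fw_q_mem_Vstar w 0⟩

/-- A vertex lies, together with a preimage that is a vertex, in a cell of every level. -/
theorem exists_word_of_mem_Vstar {y : K} (hy : y ∈ S.Vstar) (m : ℕ) :
    ∃ w : List (Fin S.N), w.length = m ∧ ∃ w' l, S.Fw w (S.Fw w' (S.q l)) = y := by
  obtain ⟨k, hk⟩ := Set.mem_iUnion.1 hy
  obtain ⟨w, hw, l, rfl⟩ := S.V_mono (le_max_left k m) hk
  refine ⟨w.take m, by simp [hw], w.drop m, l, ?_⟩
  rw [← Fw_append, List.take_append_drop]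

theorem isClosed_cell (w : List (Fin S.N)) : IsClosed (Set.range (S.Fw w)) :=
  (isCompact_range (S.Fw_continuous w)).isClosed

/-- Near `y` there are only points of cells that contain `y`. -/
theorem eventually_mem_cell (y : K) (m : ℕ) :
    ∀ᶠ z in 𝓝 y, ∀ w : List (Fin S.N), w.length = m → z ∈ Set.range (S.Fw w) →
      y ∈ Set.range (S.Fw w) := by
  have h := (eventually_all_finite (List.finite_length_eq (Fin S.N) m) (l := 𝓝 y)
    (p := fun w z => z ∈ Set.range (S.Fw w) → y ∈ Set.range (S.Fw w))).2 fun w _ => by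
      by_cases hy : y ∈ Set.range (S.Fw w)
      · exact Eventually.of_forall fun _ _ => hy
      · filter_upwards [(S.isClosed_cell w).isOpen_compl.mem_nhds hy] with z hz hz'
        exact absurd hz' hz
  filter_upwards [h] with z hz w hw
  exact hz w hw

theorem exists_vertex_of_meet {w w' : List (Fin S.N)} (hl : w.length = w'.length)
    {y : K} (hy : y ∈ Set.range (S.Fw w)) (hy' : y ∈ Set.range (S.Fw w')) (hne : w ≠ w') :
    ∃ l l', S.Fw w (S.q l) = y ∧ S.Fw w' (S.q l') = y := by
  obtain ⟨⟨_, ⟨l, rfl⟩, h⟩, ⟨_, ⟨l', rfl⟩, h'⟩⟩ := S.cell_inter w w' hl hne ⟨hy, hy'⟩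
  exact ⟨l, l', h, h'⟩

/-- The cells reachable from `i` and the remaining cells have unions that are closed and
complementary; since `K` is connected, nothing remains. -/
theorem cells_connected (i j : Fin S.N) : Relation.ReflTransGen
    (fun i j => (Set.range (S.F i) ∩ Set.range (S.F j)).Nonempty) i j := by
  set rel := fun i j => (Set.range (S.F i) ∩ Set.range (S.F j)).Nonempty
  have hcl : ∀ p : Fin S.N → Prop, IsClosed (⋃ j ∈ {j | p j}, Set.range (S.F j)) := fun p =>
    (Set.toFinite _).isClosed_biUnion fun j _ =>
      (isCompact_range (S.F_continuous j)).isClosed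
  set A := ⋃ j ∈ {j | Relation.ReflTransGen rel i j}, Set.range (S.F j) with hA
  set B := ⋃ j ∈ {j | ¬ Relation.ReflTransGen rel i j}, Set.range (S.F j) with hB
  have hAB : Aᶜ = B := by
    ext y
    constructor
    · intro hy
      obtain ⟨k, z, rfl⟩ := S.F_cover y
      refine Set.mem_biUnion (x := k) ?_ ⟨z, rfl⟩
      exact fun hk => hy (Set.mem_biUnion (x := k) hk ⟨z, rfl⟩)
    · intro hy hy'
      obtain ⟨k, hk, hyk⟩ := Set.mem_iUnion₂.1 hy
      obtain ⟨k', hk', hyk'⟩ := Set.mem_iUnion₂.1 hy'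
      exact hk (Relation.ReflTransGen.tail hk' ⟨y, hyk', hyk⟩)
  have hclop : IsClopen A := ⟨hcl _, by rw [← isClosed_compl_iff, hAB]; exact hcl _⟩
  have hAu : A = Set.univ := by
    refine (isClopen_iff.1 hclop).resolve_left (Set.Nonempty.ne_empty ⟨S.F i (S.q 0), ?_⟩)
    exact Set.mem_biUnion (x := i) Relation.ReflTransGen.refl ⟨_, rfl⟩
  obtain ⟨k, hk, hyk⟩ := Set.mem_iUnion₂.1 (hAu ▸ Set.mem_univ (S.F j (S.q 0)))
  exact Relation.ReflTransGen.tail hk ⟨_, hyk, ⟨_, rfl⟩⟩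

/-- Follow a chain of meeting cells from `i` to `j`; the constant depends only on the chain, not on
`g`. -/
theorem exists_level_one_bound : ∃ C : ℝ, 0 ≤ C ∧ ∀ (g : K → ℝ) (ε : ℝ), 0 ≤ ε →
    (∀ i l l', |g (S.F i (S.q l)) - g (S.F i (S.q l'))| ≤ ε) →
    ∀ i j, |g (S.F i (S.q 0)) - g (S.F j (S.q 0))| ≤ C * ε := by
  have key : ∀ i j, ∃ C : ℝ, 0 ≤ C ∧ ∀ (g : K → ℝ) (ε : ℝ), 0 ≤ ε →
      (∀ i l l', |g (S.F i (S.q l)) - g (S.F i (S.q l'))| ≤ ε) →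
      |g (S.F i (S.q 0)) - g (S.F j (S.q 0))| ≤ C * ε := by
    intro i j
    induction S.cells_connected i j with
    | refl => exact ⟨0, le_rfl, fun g ε _ _ => by simp⟩
    | @tail j k _ hjk ih =>
      obtain ⟨C, hC, h⟩ := ih
      -- Two more moves of cost `ε`: to the shared vertex inside cell `j`, and from it to the base
      -- vertex inside cell `k`.
      refine ⟨C + 2, by linarith, fun g ε hε hg => ?_⟩
      have h1 := h g ε hε hg
      rcases eq_or_ne j k with rfl | hne
      · linarith [mul_nonneg hC hε]
      obtain ⟨y, hy, hy'⟩ := hjk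
      obtain ⟨l, l', hl, hl'⟩ := S.exists_vertex_of_meet (w := [j]) (w' := [k]) rfl
        (y := y) hy hy' (by simpa using hne)
      have h2 := hg j 0 l
      have h3 := hg k l' 0
      have hl : S.F j (S.q l) = y := hl
      have hl' : S.F k (S.q l') = y := hl'
      rw [hl] at h2
      rw [hl'] at h3
      rw [abs_le] at *
      constructor <;> linarith
  choose C hC h using key
  refine ⟨∑ i, ∑ j, C i j, Finset.sum_nonneg fun i _ => Finset.sum_nonneg fun j _ => hC i j,
    fun g ε hε hg i j => (h i j g ε hε hg).trans (mul_le_mul_of_nonneg_right ?_ hε)⟩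
  exact (Finset.single_le_sum (fun j _ => hC i j) (Finset.mem_univ j)).trans
    (Finset.single_le_sum (f := fun i => ∑ j, C i j)
      (fun i _ => Finset.sum_nonneg fun j _ => hC i j) (Finset.mem_univ i))

end PCFStructure

/-! ### Energy controls oscillation; existence of harmonic extensions. -/

namespace D3Fractal

variable {K : Type*} [MetricSpace K] [CompactSpace K] [ConnectedSpace K]
  [MeasurableSpace K] [BorelSpace K] (S : D3Fractal K)

theorem En_succ (m : ℕ) (f g : K → ℝ) :
    S.En (m + 1) f g = ∑ i, (S.r i)⁻¹ * S.En m (f ∘ S.F i) (g ∘ S.F i) := rfl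

theorem En_zero_self (f : K → ℝ) : S.En 0 f f = (f (S.q 0) - f (S.q 1)) ^ 2 +
    (f (S.q 1) - f (S.q 2)) ^ 2 + (f (S.q 2) - f (S.q 0)) ^ 2 := by
  simp [PCFStructure.E, sq, add_assoc]

theorem En_congr {m : ℕ} {f f' g g' : K → ℝ} (hf : ∀ y ∈ S.V m, f y = f' y)
    (hg : ∀ y ∈ S.V m, g y = g' y) : S.En m f g = S.En m f' g' := by
  induction m generalizing f f' g g' with
  | zero =>
    refine Finset.sum_congr rfl fun p _ => ?_
    rw [hf _ (S.q_mem_V 0 _), hf _ (S.q_mem_V 0 _), hg _ (S.q_mem_V 0 _), hg _ (S.q_mem_V 0 _)]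
  | succ m ih =>
    refine Finset.sum_congr rfl fun i _ => ?_
    exact congrArg _ (ih (fun y hy => hf _ (S.F_mem_V hy i)) fun y hy => hg _ (S.F_mem_V hy i))

theorem En_comp_le {g : K → ℝ} {B : ℝ} {m : ℕ} (hg : S.En (m + 1) g g ≤ B) (i : Fin S.N) :
    S.En m (g ∘ S.F i) (g ∘ S.F i) ≤ S.r i * B := by
  have h1 : (S.r i)⁻¹ * S.En m (g ∘ S.F i) (g ∘ S.F i) ≤ S.En (m + 1) g g :=
    Finset.single_le_sum (f := fun i => (S.r i)⁻¹ * S.En m (g ∘ S.F i) (g ∘ S.F i))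
      (fun j _ => mul_nonneg (inv_nonneg.2 (S.r_pos j).le) (S.En_nonneg m _)) (Finset.mem_univ i)
  have := h1.trans hg
  rwa [inv_mul_le_iff₀ (S.r_pos i)] at this

theorem abs_sub_le_of_En_zero_le {g : K → ℝ} {B : ℝ} (h : S.En 0 g g ≤ B) (l l' : Fin 3) :
    |g (S.q l) - g (S.q l')| ≤ √B := by
  refine Real.abs_le_sqrt (le_trans ?_ h)
  rw [En_zero_self]
  fin_cases l <;> fin_cases l' <;> dsimp <;>
    nlinarith [sq_nonneg (g (S.q 0) - g (S.q 1)), sq_nonneg (g (S.q 1) - g (S.q 2)),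
      sq_nonneg (g (S.q 2) - g (S.q 0))]

/-- Restriction to a cell multiplies the energy bound by `r i`, hence the oscillation bound by its
square root; this is why `s` enters squared. -/
theorem exists_contraction_ratio : ∃ s : ℝ, 0 < s ∧ s < 1 ∧ ∀ i, S.r i ≤ s ^ 2 := by
  have : Nonempty (Fin S.N) := ⟨S.bd 0⟩
  obtain ⟨i, hi⟩ := Finite.exists_max S.r
  refine ⟨√(S.r i), Real.sqrt_pos.2 (S.r_pos i), ?_, fun j => ?_⟩
  · rw [Real.sqrt_lt' one_pos, one_pow]
    exact S.r_lt_one i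
  · rw [Real.sq_sqrt (S.r_pos i).le]
    exact hi j

/-- Functions of finite energy have small oscillation on the vertices of small cells. -/
theorem exists_oscillation_bound : ∃ C s : ℝ, 0 ≤ C ∧ 0 ≤ s ∧ s < 1 ∧ ∀ (g : K → ℝ) (B : ℝ),
    (∀ m, S.En m g g ≤ B) → ∀ w w' l,
      |g (S.Fw w (S.Fw w' (S.q l))) - g (S.Fw w (S.q 0))| ≤ C * s ^ w.length * √B := by
  obtain ⟨s, hs0, hs1, hs⟩ := S.exists_contraction_ratio
  obtain ⟨C₁, hC₁, h₁⟩ := S.exists_level_one_bound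
  -- `C` solves `C = C s + C₁ + 1`: one level costs `C₁`, the rest recurs with factor `s`, and the
  -- extra `1` covers the empty word.
  set C := (C₁ + 1) / (1 - s) with hCdef
  have hC : 0 ≤ C := div_nonneg (by linarith) (by linarith)
  have hCs : C * s + C₁ + 1 = C := by
    have : C * (1 - s) = C₁ + 1 := div_mul_cancel₀ _ (by linarith)
    linarith
  have hcomp : ∀ (g : K → ℝ) (B : ℝ), (∀ m, S.En m g g ≤ B) → ∀ i m,
      S.En m (g ∘ S.F i) (g ∘ S.F i) ≤ s ^ 2 * B := fun g B hg i m =>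
    (S.En_comp_le (hg (m + 1)) i).trans
      (mul_le_mul_of_nonneg_right (hs i) ((S.En_nonneg 0 g).trans (hg 0)))
  have hsqrt : ∀ B, √(s ^ 2 * B) = s * √B := fun B => by
    rw [Real.sqrt_mul (sq_nonneg s), Real.sqrt_sq hs0.le]
  have hroot : ∀ (w : List (Fin S.N)) (l : Fin 3) (g : K → ℝ) (B : ℝ), (∀ m, S.En m g g ≤ B) →
      |g (S.Fw w (S.q l)) - g (S.q 0)| ≤ C * √B := by
    intro w l
    induction w with
    | nil =>
      intro g B hg
      refine (S.abs_sub_le_of_En_zero_le (hg 0) l 0).trans ?_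
      nlinarith [Real.sqrt_nonneg B, mul_nonneg hC hs0.le]
    | cons i w ih =>
      intro g B hg
      have h2 := ih (g ∘ S.F i) (s ^ 2 * B) (hcomp g B hg i)
      rw [hsqrt] at h2
      -- `q 0` is itself a level-one vertex, being fixed by `F (bd 0)`, so the level-one bound
      -- compares `F i (q 0)` with it.
      have h3 := h₁ g (√B) (Real.sqrt_nonneg B) (fun j l l' => by
        refine (S.abs_sub_le_of_En_zero_le (hcomp g B hg j 0) l l').trans ?_
        rw [hsqrt]
        nlinarith [Real.sqrt_nonneg B]) i (S.bd 0)
      rw [S.F_bd] at h3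
      have h4 : g (S.Fw (i :: w) (S.q l)) - g (S.q 0) =
          ((g ∘ S.F i) (S.Fw w (S.q l)) - (g ∘ S.F i) (S.q 0)) +
            (g (S.F i (S.q 0)) - g (S.q 0)) := by
        simp [PCFStructure.Fw_cons]
      rw [h4]
      refine (abs_add_le _ _).trans ((add_le_add h2 h3).trans ?_)
      have h5 := Real.sqrt_nonneg B
      nlinarith
  refine ⟨C, s, hC, hs0.le, hs1, fun g B hg w w' l => ?_⟩
  induction w generalizing g B with
  | nil => simpa [PCFStructure.Fw_nil] using hroot w' l g B hg
  | cons i w ih =>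
    have := ih (g ∘ S.F i) (s ^ 2 * B) (hcomp g B hg i)
    rw [hsqrt] at this
    rw [List.length_cons, pow_succ]
    calc _ ≤ C * s ^ w.length * (s * √B) := this
      _ = _ := by ring

/-- A continuous function without energy is constant. -/
theorem eq_of_En_eq_zero {g : K → ℝ} (hc : Continuous g) (h : ∀ m, S.En m g g = 0) (y : K) :
    g y = g (S.q 0) := by
  obtain ⟨C, s, -, -, -, hC⟩ := S.exists_oscillation_bound
  refine congrFun (hc.ext_on S.dense_Vstar continuous_const fun z hz => ?_) y
  obtain ⟨w, l, rfl⟩ := S.mem_Vstar_iff.1 hz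
  have := hC g 0 (fun m => (h m).le) [] w l
  rw [Real.sqrt_zero, mul_zero] at this
  exact sub_eq_zero.1 (abs_nonpos_iff.1 this)

/-- A function of bounded energies on the vertices extends to a continuous function. -/
theorem exists_continuous_extension {g : K → ℝ} {B : ℝ} (hg : ∀ m, S.En m g g ≤ B) :
    ∃ f : K → ℝ, Continuous f ∧ ∀ y ∈ S.Vstar, f y = g y := by
  obtain ⟨C, s, hC0, hs0, hs1, hC⟩ := S.exists_oscillation_bound
  have hd : IsDenseInducing ((↑) : S.Vstar → K) := S.dense_Vstar.isDenseInducing_val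
  have hcauchy : ∀ y : K, Cauchy (map (fun z : S.Vstar => g z) (comap (↑) (𝓝 y))) := by
    intro y
    have : (comap ((↑) : S.Vstar → K) (𝓝 y)).NeBot := hd.comap_nhds_neBot y
    refine Metric.cauchy_iff.2 ⟨inferInstance, fun ε hε => ?_⟩
    -- Four legs of equal cost join the values at two nearby vertices: each to the base vertex of
    -- its cell, and each base vertex to `y`.
    have ht : Tendsto (fun m : ℕ => 4 * (C * s ^ m * √B)) atTop (𝓝 0) := by
      simpa using ((tendsto_pow_atTop_nhds_zero_of_lt_one hs0 hs1).const_mul C).mul_const √B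
        |>.const_mul 4
    obtain ⟨m, hm⟩ := (ht.eventually_lt_const hε).exists
    refine ⟨_, image_mem_map (preimage_mem_comap (S.eventually_mem_cell y m)), ?_⟩
    rintro _ ⟨a, ha, rfl⟩ _ ⟨b, hb, rfl⟩
    obtain ⟨w, hw, w₁, l, hwa⟩ := S.exists_word_of_mem_Vstar a.2 m
    obtain ⟨v, hv, v₁, k, hvb⟩ := S.exists_word_of_mem_Vstar b.2 m
    have hyw := ha w hw ⟨_, hwa⟩
    have hyv := hb v hv ⟨_, hvb⟩
    have h1 := hC g B hg w w₁ l
    have h2 := hC g B hg v v₁ k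
    rw [hwa, hw] at h1
    rw [hvb, hv] at h2
    -- Both cells contain `y`; if they differ, `y` is a vertex of both and `g y` serves as the
    -- intermediate value.
    have h3 : |g (S.Fw w (S.q 0)) - g (S.Fw v (S.q 0))| ≤ 2 * (C * s ^ m * √B) := by
      rcases eq_or_ne w v with rfl | hne
      · have : 0 ≤ C * s ^ m * √B := by positivity
        simpa using this
      obtain ⟨j, j', hj, hj'⟩ := S.exists_vertex_of_meet (hw.trans hv.symm) hyw hyv hne
      have h4 := hC g B hg w [] j
      have h5 := hC g B hg v [] j'
      have e1 : S.Fw w (S.Fw [] (S.q j)) = y := hj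
      have e2 : S.Fw v (S.Fw [] (S.q j')) = y := hj'
      rw [e1, hw] at h4
      rw [e2, hv] at h5
      rw [abs_le] at *
      constructor <;> linarith
    rw [Real.dist_eq]
    refine lt_of_le_of_lt ?_ hm
    rw [abs_le] at *
    constructor <;> linarith
  have hlim : ∀ y : K, ∃ c, Tendsto (fun z : S.Vstar => g z) (comap (↑) (𝓝 y)) (𝓝 c) :=
    fun y => CompleteSpace.complete (hcauchy y)
  refine ⟨hd.extend fun z : S.Vstar => g z, hd.continuous_extend hlim, fun y hy => ?_⟩
  obtain ⟨c, hc⟩ := hlim y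
  have h1 : hd.extend (fun z : S.Vstar => g z) y = c := hd.extend_eq_of_tendsto hc
  rw [h1]
  -- The limit is taken over a filter that includes the vertex itself, so it equals the value there.
  have h2 := hc.mono_left (show pure (⟨y, hy⟩ : S.Vstar) ≤ comap (↑) (𝓝 y) from
    (pure_le_nhds _).trans (hd.isInducing.nhds_eq_comap _).le)
  exact (tendsto_nhds_unique h2 (tendsto_pure_nhds _ _))

/-- Successive energy minimizers agree on earlier vertices and keep the energy constant. Their
common values on `V_*` have bounded energy and extend continuously. -/
theorem exists_harmonic_extension (a : Fin 3 → ℝ) :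
    ∃ h : S.harmonic, ∀ l, h.1 (S.q l) = a l := by
  choose next hnext using fun (m : ℕ) (f : K → ℝ) => (S.E_restrict m f).1
  set f₀ : K → ℝ := Function.extend S.q a 0
  set f : ℕ → K → ℝ := fun m => Nat.rec f₀ next m with hf
  have hsucc : ∀ m, f (m + 1) = next m (f m) := fun m => rfl
  have hle : ∀ m k, ∀ y ∈ S.V m, f (m + k) y = f m y := by
    intro m k y hy
    induction k with
    | zero => rfl
    | succ k ih =>
      rw [← add_assoc, hsucc, (hnext _ _).1 y (S.V_mono (Nat.le_add_right m k) hy), ih]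
  have hen : ∀ m, S.En m (f m) (f m) = S.En 0 f₀ f₀ := by
    intro m
    induction m with
    | zero => rfl
    | succ m ih => rw [← ih]; exact (hnext m (f m)).2
  classical
  set g : K → ℝ := fun y => if h : ∃ m, y ∈ S.V m then f (Nat.find h) y else 0
  have hg : ∀ m, ∀ y ∈ S.V m, g y = f m y := by
    intro m y hy
    have h : ∃ m, y ∈ S.V m := ⟨m, hy⟩
    have hk := Nat.find_min' h hy
    obtain ⟨k, hk⟩ := Nat.exists_eq_add_of_le hk
    have : g y = f (Nat.find h) y := dif_pos h
    rw [this]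
    conv_rhs => rw [hk]
    exact (hle _ k y (Nat.find_spec h)).symm
  have hgen : ∀ m, S.En m g g = S.En 0 f₀ f₀ := fun m => by
    rw [← hen m]
    exact S.En_congr (hg m) (hg m)
  obtain ⟨u, hu, hug⟩ := S.exists_continuous_extension fun m => (hgen m).le
  have huen : ∀ m, S.En m u u = S.En 0 f₀ f₀ := fun m => by
    rw [← hgen m]
    have : ∀ y ∈ S.V m, u y = g y := fun y hy => hug y (Set.mem_iUnion.2 ⟨m, hy⟩)
    exact S.En_congr this this
  refine ⟨⟨⟨u, hu⟩, fun m => (huen (m + 1)).trans (huen m).symm⟩, fun l => ?_⟩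
  change u (S.q l) = a l
  rw [hug _ (Set.mem_iUnion.2 ⟨0, S.q_mem_V 0 l⟩), hg 0 _ (S.q_mem_V 0 l)]
  exact S.q_injective.extend_apply a 0 l

end D3Fractal

/-! ### Harmonic functions, their symmetries and the eigenvalues of `M`. -/

namespace D3Fractal

variable {K : Type*} [MetricSpace K] [CompactSpace K] [ConnectedSpace K]
  [MeasurableSpace K] [BorelSpace K] (S : D3Fractal K)

theorem En_add_right (m : ℕ) (f g g' : K → ℝ) :
    S.En m f (g + g') = S.En m f g + S.En m f g' := by
  rw [En_symm, En_add_left, En_symm, En_symm S m g' f]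

theorem En_smul_right (m : ℕ) (c : ℝ) (f g : K → ℝ) :
    S.En m f (c • g) = c * S.En m f g := by
  rw [En_symm, En_smul_left, En_symm]

theorem En_add_smul_self (m : ℕ) (c : ℝ) (f g : K → ℝ) :
    S.En m (f + c • g) (f + c • g) = S.En m f f + 2 * c * S.En m f g + c ^ 2 * S.En m g g := by
  simp only [En_add_left, En_add_right, En_smul_left, En_smul_right, S.En_symm m g f]
  ring

theorem En_zero_left (m : ℕ) (g : K → ℝ) : S.En m 0 g = 0 := by
  have := S.En_smul_left m 0 0 g
  rwa [smul_zero, zero_mul] at this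

theorem En_zero_right (m : ℕ) (g : K → ℝ) : S.En m g 0 = 0 := by
  rw [En_symm, En_zero_left]

/-- The energy of a harmonic function against any function is the same at all levels. -/
theorem En_harmonic {h : K → ℝ} (hh : ∀ m, S.En (m + 1) h h = S.En m h h) (m : ℕ) (v : K → ℝ) :
    S.En m h v = S.En 0 h v := by
  induction m with
  | zero => rfl
  | succ m ih =>
    rw [← ih]
    set a := S.En (m + 1) h v - S.En m h v with ha
    set b := S.En (m + 1) v v - S.En m v v with hb
    -- `E_{m+1} - E_m` is nonnegative at `h + t v` and zero at `h`; a nonnegative quadratic in `t`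
    -- without constant term has no linear term.
    have hq : ∀ t : ℝ, 0 ≤ b * (t * t) + 2 * a * t + 0 := fun t => by
      have h1 := S.En_mono m (h + t • v)
      rw [En_add_smul_self, En_add_smul_self, hh m] at h1
      rw [ha, hb]
      nlinarith
    have := discrim_le_zero hq
    have ha0 : a = 0 := by
      rw [discrim] at this
      nlinarith [sq_nonneg a]
    linarith

theorem harmonic_eq_zero {h : S.harmonic} (h0 : ∀ l, h.1 (S.q l) = 0) : h = 0 := by
  have hz : ∀ m, S.En m h.1 h.1 = 0 := fun m => by
    rw [S.En_harmonic h.2, En_zero_self]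
    simp [h0]
  ext y
  rw [S.eq_of_En_eq_zero h.1.continuous hz y, h0]
  rfl

theorem harmonic_ext {h h' : S.harmonic} (h0 : ∀ l, h.1 (S.q l) = h'.1 (S.q l)) : h = h' := by
  refine sub_eq_zero.1 (S.harmonic_eq_zero fun l => ?_)
  exact sub_eq_zero.2 (h0 l)

theorem sym_mul_apply (σ τ : Equiv.Perm (Fin 3)) (y : K) :
    S.sym σ (S.sym τ y) = S.sym (σ * τ) y := by
  rw [map_mul]; rfl

theorem sym_one_apply (y : K) : S.sym 1 y = y := by
  rw [map_one]; rfl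

theorem sym_bd (σ : Equiv.Perm (Fin 3)) (l : Fin 3) (y : K) :
    S.sym σ (S.F (S.bd l) y) = S.F (S.bd (σ l)) (S.sym σ y) := S.sym_F σ l y

/-- The action of the symmetries on harmonic functions. -/
def harmonicComp (σ : Equiv.Perm (Fin 3)) (h : S.harmonic) : S.harmonic :=
  ⟨h.1.comp ⟨S.sym σ, (S.sym σ).continuous⟩, fun m => by
    have h1 := S.sym_E σ (m + 1) h.1
    have h2 := S.sym_E σ m h.1
    exact h1.trans ((h.2 m).trans h2.symm)⟩

theorem M_harmonicComp (σ : Equiv.Perm (Fin 3)) (l : Fin 3) (h : S.harmonic) :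
    S.M l (S.harmonicComp σ h) = S.harmonicComp σ (S.M (σ l) h) := by
  ext y
  exact congrArg h.1 (S.sym_bd σ l y)

theorem F_bd_eq_q_iff {i : Fin S.N} {y : K} {l : Fin 3} :
    S.F i y = S.q l ↔ i = S.bd l ∧ y = S.q l := by
  constructor
  · intro h
    have hi : i = S.bd l := by
      by_contra hne
      exact S.q_not_mem l i (S.bd l) hne ⟨⟨y, h⟩, ⟨_, S.F_bd l⟩⟩
    subst hi
    exact ⟨rfl, S.F_injective _ (h.trans (S.F_bd l).symm)⟩
  · rintro ⟨rfl, rfl⟩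
    exact S.F_bd l

/-- The flux of a harmonic function through `q 0` scales by `r` under `M 0`. -/
theorem flux_M (h : S.harmonic) :
    2 * (S.M 0 h).1 (S.q 0) - (S.M 0 h).1 (S.q 1) - (S.M 0 h).1 (S.q 2) =
      S.rb * (2 * h.1 (S.q 0) - h.1 (S.q 1) - h.1 (S.q 2)) := by
  classical
  -- Pairing with the indicator of `q 0` gives the flux at level zero. At level one only the cell of
  -- `bd 0` contains `q 0`, and it carries the factor `r⁻¹`.
  set δ : K → ℝ := Pi.single (S.q 0) 1
  have hδ0 : δ (S.q 0) = 1 := Pi.single_eq_same _ _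
  have hδ : ∀ y, y ≠ S.q 0 → δ y = 0 := fun y hy => Pi.single_eq_of_ne hy _
  have h1 : S.q 1 ≠ S.q 0 := S.q_injective.ne (by decide)
  have h2 : S.q 2 ≠ S.q 0 := S.q_injective.ne (by decide)
  have hE0 : ∀ f : K → ℝ, S.En 0 f δ = 2 * f (S.q 0) - f (S.q 1) - f (S.q 2) := fun f => by
    simp [PCFStructure.E, hδ0, hδ _ h1, hδ _ h2]
    ring
  have hcomp0 : δ ∘ S.F (S.bd 0) = δ := by
    ext y
    by_cases hy : y = S.q 0
    · simp [hy, S.F_bd]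
    · rw [hδ y hy]
      exact hδ _ fun h => hy (S.F_bd_eq_q_iff.1 h).2
  have hcomp : ∀ i, i ≠ S.bd 0 → δ ∘ S.F i = 0 := fun i hi => by
    ext y
    exact hδ _ fun h => hi (S.F_bd_eq_q_iff.1 h).1
  have key := S.En_harmonic h.2 1 δ
  rw [En_succ, Finset.sum_eq_single (S.bd 0) (fun i _ hi => by
    rw [hcomp i hi, En_zero_right, mul_zero]) (by simp), hcomp0, hE0, hE0,
    inv_mul_eq_iff_eq_mul₀ (S.r_pos _).ne'] at key
  exact key

/-- The value, the flux and the transverse difference of a harmonic function at `q 0`. -/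
def jetMap : S.harmonic →ₗ[ℝ] (Fin 3 → ℝ) where
  toFun h := ![h.1 (S.q 0), 2 * h.1 (S.q 0) - h.1 (S.q 1) - h.1 (S.q 2),
    h.1 (S.q 1) - h.1 (S.q 2)]
  map_add' h h' := by
    ext i
    fin_cases i <;> simp <;> ring
  map_smul' c h := by
    ext i
    fin_cases i <;> simp <;> ring

theorem jetMap_injective : Function.Injective S.jetMap := by
  intro h h' hj
  have h0 : h.1 (S.q 0) = h'.1 (S.q 0) := congrFun hj 0
  have h1 : 2 * h.1 (S.q 0) - h.1 (S.q 1) - h.1 (S.q 2) =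
    2 * h'.1 (S.q 0) - h'.1 (S.q 1) - h'.1 (S.q 2) := congrFun hj 1
  have h2 : h.1 (S.q 1) - h.1 (S.q 2) = h'.1 (S.q 1) - h'.1 (S.q 2) := congrFun hj 2
  refine S.harmonic_ext fun l => ?_
  fin_cases l
  · exact h0
  · change h.1 (S.q 1) = h'.1 (S.q 1)
    linarith
  · change h.1 (S.q 2) = h'.1 (S.q 2)
    linarith

theorem jetMap_surjective : Function.Surjective S.jetMap := by
  intro a
  obtain ⟨h, hh⟩ := S.exists_harmonic_extension
    ![a 0, (2 * a 0 - a 1 + a 2) / 2, (2 * a 0 - a 1 - a 2) / 2]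
  have h0 : h.1 (S.q 0) = a 0 := hh 0
  have h1 : h.1 (S.q 1) = (2 * a 0 - a 1 + a 2) / 2 := hh 1
  have h2 : h.1 (S.q 2) = (2 * a 0 - a 1 - a 2) / 2 := hh 2
  refine ⟨h, ?_⟩
  ext i
  fin_cases i
  · exact h0
  · change 2 * h.1 (S.q 0) - h.1 (S.q 1) - h.1 (S.q 2) = a 1
    rw [h0, h1, h2]
    ring
  · change h.1 (S.q 1) - h.1 (S.q 2) = a 2
    rw [h1, h2]
    ring

/-- The harmonic functions in the coordinates of `jetMap`. -/
noncomputable def jetEquiv : S.harmonic ≃ₗ[ℝ] (Fin 3 → ℝ) :=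
  LinearEquiv.ofBijective S.jetMap ⟨S.jetMap_injective, S.jetMap_surjective⟩

/-- Such `h` is invariant under the swap of `q 1` and `q 2`, having the same boundary values as its
image, and `M 0` commutes with this swap. -/
theorem M_transverse_zero {h : S.harmonic} (hT : h.1 (S.q 1) = h.1 (S.q 2)) :
    (S.M 0 h).1 (S.q 1) = (S.M 0 h).1 (S.q 2) := by
  have hs : S.harmonicComp (Equiv.swap 1 2) h = h := S.harmonic_ext fun l => by
    change h.1 (S.sym (Equiv.swap 1 2) (S.q l)) = _
    rw [S.sym_q]
    fin_cases l
    · rfl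
    · exact hT.symm
    · exact hT
  have h1 := S.M_harmonicComp (Equiv.swap 1 2) 0 h
  rw [hs] at h1
  conv_lhs => rw [h1]
  change (S.M 0 h).1 (S.sym (Equiv.swap 1 2) (S.q 1)) = _
  rw [S.sym_q]
  rfl

/-- The transverse difference of a harmonic function at `q 0` scales by `lam` under `M 0`. -/
theorem transverse_M (h : S.harmonic) :
    (S.M 0 h).1 (S.q 1) - (S.M 0 h).1 (S.q 2) = S.lam * (h.1 (S.q 1) - h.1 (S.q 2)) := by
  set e := S.jetEquiv.symm (Pi.single 2 1) with he
  have hje : S.jetMap e = Pi.single 2 1 := S.jetEquiv.apply_symm_apply _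
  have heT : e.1 (S.q 1) - e.1 (S.q 2) = 1 := congrFun hje 2
  set c := (S.M 0 e).1 (S.q 1) - (S.M 0 e).1 (S.q 2) with hc
  -- `M 0` preserves the kernel of the transverse difference, so on that difference it acts by a
  -- scalar `c`, read off from `e`.
  have key : ∀ h : S.harmonic, (S.M 0 h).1 (S.q 1) - (S.M 0 h).1 (S.q 2) =
      c * (h.1 (S.q 1) - h.1 (S.q 2)) := by
    intro h
    set t := h.1 (S.q 1) - h.1 (S.q 2) with ht
    have h1 := S.M_transverse_zero (h := h - t • e) (by
      change h.1 (S.q 1) - t * e.1 (S.q 1) = h.1 (S.q 2) - t * e.1 (S.q 2)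
      linear_combination -ht - t * heT)
    rw [map_sub, map_smul] at h1
    change (S.M 0 h).1 (S.q 1) - t * (S.M 0 e).1 (S.q 1) =
      (S.M 0 h).1 (S.q 2) - t * (S.M 0 e).1 (S.q 2) at h1
    rw [hc]
    linear_combination h1
  -- In jet coordinates `M 0` is diagonal, so its trace identifies `c` with `lam`.
  have hconj : S.jetEquiv.conj (S.M 0) = Matrix.toLin' (Matrix.diagonal ![1, S.rb, c]) := by
    refine LinearMap.ext fun a => ?_
    obtain ⟨h, rfl⟩ := S.jetEquiv.surjective a
    rw [LinearEquiv.conj_apply_apply, LinearEquiv.symm_apply_apply]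
    ext i
    rw [Matrix.toLin'_apply, Matrix.mulVec_diagonal]
    fin_cases i
    · change h.1 (S.F (S.bd 0) (S.q 0)) = 1 * h.1 (S.q 0)
      rw [S.F_bd, one_mul]
    · exact S.flux_M h
    · exact key h
  have htr : LinearMap.trace ℝ S.harmonic (S.M 0) = 1 + S.rb + c := by
    rw [← LinearMap.trace_conj' (S.M 0) S.jetEquiv, hconj, Matrix.trace_toLin'_eq,
      Matrix.trace_diagonal, Fin.sum_univ_three]
    rfl
  have hlam : S.lam = c := by
    rw [lam, htr]
    ring
  rw [hlam]
  exact key h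

/-- The harmonic function with jet `(0, 0, 1)` is an eigenvector for `lam`; if `lam = 0` it lies in
the kernel of `M 0`. -/
theorem lam_ne_zero (hM : Function.Injective (S.M 0)) : S.lam ≠ 0 := by
  intro h0
  obtain ⟨e, he⟩ := S.jetMap_surjective (Pi.single 2 1)
  have e0 : e.1 (S.q 0) = 0 := congrFun he 0
  have e1 : 2 * e.1 (S.q 0) - e.1 (S.q 1) - e.1 (S.q 2) = 0 := congrFun he 1
  have e2 : e.1 (S.q 1) - e.1 (S.q 2) = 1 := congrFun he 2
  have hMe : S.M 0 e = 0 := by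
    refine S.jetMap_injective ?_
    ext i
    rw [map_zero]
    fin_cases i
    · change e.1 (S.F (S.bd 0) (S.q 0)) = 0
      rw [S.F_bd, e0]
    · exact (S.flux_M e).trans (by rw [e1, mul_zero]; rfl)
    · exact (S.transverse_M e).trans (by rw [h0, zero_mul]; rfl)
  have : e = 0 := hM (hMe.trans (map_zero _).symm)
  rw [this] at e2
  simp at e2

theorem refl_eq (l : Fin 3) : S.refl l = S.sym (Equiv.swap (l + 1) (l - 1)) := rfl

theorem rot_eq (l : Fin 3) : S.rot l = S.sym (Equiv.addRight l) := rfl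

theorem refl_refl (l : Fin 3) (y : K) : S.refl l (S.refl l y) = y := by
  rw [refl_eq, sym_mul_apply, Equiv.swap_mul_self, sym_one_apply]

theorem refl_q (l : Fin 3) : S.refl l (S.q l) = S.q l := by
  rw [refl_eq, S.sym_q]
  exact congrArg S.q (by revert l; decide)

theorem refl_q_add (l : Fin 3) : S.refl l (S.q (l + 1)) = S.q (l - 1) := by
  rw [refl_eq, S.sym_q, Equiv.swap_apply_left]

theorem refl_q_sub (l : Fin 3) : S.refl l (S.q (l - 1)) = S.q (l + 1) := by
  rw [refl_eq, S.sym_q, Equiv.swap_apply_right]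

theorem refl_F (l : Fin 3) (y : K) : S.refl l (S.F (S.bd l) y) = S.F (S.bd l) (S.refl l y) := by
  rw [refl_eq, sym_bd]
  exact congrArg (fun k => S.F (S.bd k) _) (by revert l; decide)

theorem rot_q (i l : Fin 3) : S.rot i (S.q l) = S.q (l + i) := S.sym_q _ l

theorem rot_F (i l : Fin 3) (y : K) :
    S.rot i (S.F (S.bd l) y) = S.F (S.bd (l + i)) (S.rot i y) := S.sym_bd _ l y

theorem rot_add (i j : Fin 3) (y : K) : S.rot i (S.rot j y) = S.rot (j + i) y := by
  rw [rot_eq, rot_eq, sym_mul_apply, rot_eq]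
  exact congrArg (fun σ => S.sym σ y) (by revert i j; decide)

theorem refl_rot (l : Fin 3) (y : K) : S.refl l (S.rot l y) = S.rot l (S.refl 0 y) := by
  rw [refl_eq, rot_eq, sym_mul_apply, refl_eq, sym_mul_apply]
  exact congrArg (fun σ => S.sym σ y) (by revert l; decide)

/-- `M l` acts on the harmonic functions odd under the reflection at `q l` as multiplication
by `lam`. -/
theorem M_odd {h : S.harmonic} {l : Fin 3} (ho : ∀ y, h.1 (S.refl l y) = -h.1 y) :
    S.M l h = S.lam • h := by
  have key : ∀ h : S.harmonic, (∀ y, h.1 (S.refl 0 y) = -h.1 y) → S.M 0 h = S.lam • h := by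
    intro h ho
    have h0 : h.1 (S.q 0) = 0 := by
      have := ho (S.q 0)
      rw [S.refl_q] at this
      linarith
    have h1 : h.1 (S.q 2) = -h.1 (S.q 1) := by
      rw [← ho, show (1 : Fin 3) = 0 + 1 from rfl, S.refl_q_add]
      rfl
    refine S.jetMap_injective ?_
    ext i
    fin_cases i
    · change h.1 (S.F (S.bd 0) (S.q 0)) = S.lam * h.1 (S.q 0)
      rw [S.F_bd, h0, mul_zero]
    · refine (S.flux_M h).trans ?_
      change _ = 2 * (S.lam * h.1 (S.q 0)) - S.lam * h.1 (S.q 1) - S.lam * h.1 (S.q 2)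
      rw [h0, h1]
      ring
    · refine (S.transverse_M h).trans ?_
      change _ = S.lam * h.1 (S.q 1) - S.lam * h.1 (S.q 2)
      ring
  -- Rotation carries the reflection at `q 0` to the one at `q l`, and `M 0` to `M l`.
  have h1 := key (S.harmonicComp (Equiv.addRight l) h) fun y => by
    change h.1 (S.rot l (S.refl 0 y)) = -h.1 (S.rot l y)
    rw [← refl_rot, ho]
  rw [M_harmonicComp] at h1
  have hl : (Equiv.addRight l) (0 : Fin 3) = l := zero_add l
  rw [hl] at h1
  ext y
  have h2 := DFunLike.congr_fun (congrArg Subtype.val h1) (S.rot (-l) y)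
  change (S.M l h).1 (S.rot l (S.rot (-l) y)) = S.lam * h.1 (S.rot l (S.rot (-l) y)) at h2
  rwa [rot_add, neg_add_cancel, rot_eq, show Equiv.addRight (0 : Fin 3) = 1 by ext; simp,
    sym_one_apply] at h2

end D3Fractal

/-! ### The weak Laplacian: localization, symmetry and uniqueness. -/

namespace D3Fractal

variable {K : Type*} [MetricSpace K] [CompactSpace K] [ConnectedSpace K]
  [MeasurableSpace K] [BorelSpace K] (S : D3Fractal K)

/-- A function is continuous if it is continuous on each cell of level one. -/
theorem continuous_of_comp_F {X : Type*} [TopologicalSpace X] {f : K → X}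
    (hf : ∀ i, Continuous (f ∘ S.F i)) : Continuous f := by
  have hp : Continuous (fun p : Σ _ : Fin S.N, K => S.F p.1 p.2) :=
    continuous_sigma fun i => S.continuous_F i
  have hs : Function.Surjective (fun p : Σ _ : Fin S.N, K => S.F p.1 p.2) := fun y => by
    obtain ⟨i, z, h⟩ := S.F_cover y
    exact ⟨⟨i, z⟩, h⟩
  rw [(IsQuotientMap.of_surjective_continuous hs hp).continuous_iff]
  exact continuous_sigma hf

theorem integral_eq_sum {u : K → ℝ} (hu : Continuous u) :
    ∫ y, u y ∂S.μ = ∑ i, S.wt i * ∫ y, u (S.F i y) ∂S.μ := by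
  have := S.μ_prob
  have hμ : S.μ = ∑ i, ENNReal.ofReal (S.wt i) • S.μ.map (S.F i) := by
    ext A hA
    rw [S.μ_selfSimilar A hA, Measure.finsetSum_apply]
    refine Finset.sum_congr rfl fun i _ => ?_
    rw [Measure.smul_apply, Measure.map_apply (S.continuous_F i).measurable hA, smul_eq_mul]
  have hint : ∀ i, Integrable u (S.μ.map (S.F i)) := fun i =>
    hu.integrable_of_hasCompactSupport (HasCompactSupport.of_compactSpace _)
  conv_lhs => rw [hμ]
  rw [integral_finsetSum_measure fun i _ => (hint i).smul_measure ENNReal.ofReal_ne_top]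
  refine Finset.sum_congr rfl fun i _ => ?_
  rw [integral_smul_measure, ENNReal.toReal_ofReal (S.wt_pos i).le, smul_eq_mul,
    integral_map (S.continuous_F i).aemeasurable hu.aestronglyMeasurable]

/-- A test function: of finite energy and zero on the boundary. -/
def IsTest (v : K → ℝ) : Prop := S.DomE v ∧ ∀ l, v (S.q l) = 0

/-- The function that is `v ∘ (F i)⁻¹` on the cell of `i` and zero elsewhere. -/
noncomputable def cellExt (i : Fin S.N) (v : K → ℝ) : K → ℝ := Function.extend (S.F i) v 0

variable {S}

theorem cellExt_comp_self (i : Fin S.N) (v : K → ℝ) : S.cellExt i v ∘ S.F i = v :=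
  Function.extend_comp (S.F_injective i) v 0

/-- A point common to both cells is the image under `F i` of a boundary point, where `v` vanishes.
-/
theorem cellExt_comp_of_ne {i j : Fin S.N} (hij : j ≠ i) {v : K → ℝ}
    (hv : ∀ l, v (S.q l) = 0) : S.cellExt i v ∘ S.F j = 0 := by
  ext y
  by_cases h : ∃ z, S.F i z = S.F j y
  · obtain ⟨z, hz⟩ := h
    obtain ⟨l, l', hl, hl'⟩ := S.exists_vertex_of_meet (w := [i]) (w' := [j]) rfl
      (y := S.F j y) ⟨z, hz⟩ ⟨y, rfl⟩ (by simpa using hij.symm)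
    have hl : S.F i (S.q l) = S.F j y := hl
    rw [Function.comp_apply, ← hl]
    exact (congrFun (cellExt_comp_self i v) (S.q l)).trans (hv l)
  · exact Function.extend_apply' _ _ _ h

theorem En_cellExt (m : ℕ) (i : Fin S.N) (f : K → ℝ) {v : K → ℝ} (hv : ∀ l, v (S.q l) = 0) :
    S.En (m + 1) f (S.cellExt i v) = (S.r i)⁻¹ * S.En m (f ∘ S.F i) v := by
  rw [En_succ, Finset.sum_eq_single i (fun j _ hj => by
    rw [cellExt_comp_of_ne hj hv, En_zero_right, mul_zero]) (by simp), cellExt_comp_self]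

theorem IsTest.cellExt {v : K → ℝ} (hv : S.IsTest v) (i : Fin S.N) :
    S.IsTest (S.cellExt i v) := by
  refine ⟨⟨S.continuous_of_comp_F fun j => ?_, ?_⟩, fun l => ?_⟩
  · rcases eq_or_ne j i with rfl | hj
    · rw [cellExt_comp_self]
      exact hv.1.1
    · rw [cellExt_comp_of_ne hj hv.2]
      exact continuous_zero
  · obtain ⟨B, hB⟩ := hv.1.2
    refine ⟨(S.r i)⁻¹ * B, ?_⟩
    rintro _ ⟨m, rfl⟩
    refine (S.En_mono m _).trans ?_
    rw [En_cellExt m i _ hv.2, cellExt_comp_self]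
    exact mul_le_mul_of_nonneg_left (hB ⟨m, rfl⟩) (inv_nonneg.2 (S.r_pos i).le)
  · rw [← S.F_bd l]
    rcases eq_or_ne (S.bd l) i with rfl | hj
    · exact (congrFun (cellExt_comp_self _ v) (S.q l)).trans (hv.2 l)
    · exact congrFun (cellExt_comp_of_ne hj hv.2) (S.q l)

theorem integral_mul_cellExt {u v : K → ℝ} (hu : Continuous u) (hv : S.IsTest v)
    (i : Fin S.N) :
    ∫ y, u y * S.cellExt i v y ∂S.μ = S.wt i * ∫ y, u (S.F i y) * v y ∂S.μ := by
  rw [S.integral_eq_sum (u := fun y => u y * S.cellExt i v y) (hu.mul (hv.cellExt i).1.1),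
    Finset.sum_eq_single i (fun j _ hj => ?_)
    (by simp)]
  · congr 2
    ext y
    exact congrArg _ (congrFun (cellExt_comp_self i v) y)
  · have h : ∀ y, S.cellExt i v (S.F j y) = 0 := congrFun (cellExt_comp_of_ne hj hv.2)
    simp [h]

theorem DomE.comp_F {f : K → ℝ} (hf : S.DomE f) (i : Fin S.N) : S.DomE (f ∘ S.F i) := by
  refine ⟨hf.1.comp (S.continuous_F i), ?_⟩
  obtain ⟨B, hB⟩ := hf.2
  refine ⟨S.r i * B, ?_⟩
  rintro _ ⟨m, rfl⟩
  exact S.En_comp_le (hB ⟨m + 1, rfl⟩) i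

/-- Test with `cellExt i v`: the energy of level `m + 1` contributes `r_i⁻¹` and the integral
contributes the weight `μ_i`. -/
theorem IsLap.comp_F {f u : K → ℝ} (h : S.IsLap f u) (i : Fin S.N) :
    S.IsLap (f ∘ S.F i) ((S.r i * S.wt i) • (u ∘ S.F i)) := by
  refine ⟨h.1.comp_F i, (h.2.1.comp (S.continuous_F i)).const_smul _, fun v hv hv0 => ?_⟩
  have ht := IsTest.cellExt (S := S) ⟨hv, hv0⟩ i
  have h1 := ((h.2.2 _ ht.1 ht.2).comp (tendsto_add_atTop_nat 1)).const_mul (S.r i)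
  rw [integral_mul_cellExt h.2.1 ⟨hv, hv0⟩] at h1
  have h2 : -∫ y, ((S.r i * S.wt i) • (u ∘ S.F i)) y * v y ∂S.μ =
      S.r i * -(S.wt i * ∫ y, u (S.F i y) * v y ∂S.μ) := by
    simp only [Pi.smul_apply, Function.comp_apply, smul_eq_mul, mul_assoc, integral_const_mul]
    ring
  rw [h2]
  refine h1.congr fun m => ?_
  rw [Function.comp_apply, En_cellExt m i f hv0, mul_inv_cancel_left₀ (S.r_pos i).ne']

/-- Polarization of `sym_E`. -/
theorem En_comp_sym (σ : Equiv.Perm (Fin 3)) (m : ℕ) (f g : K → ℝ) :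
    S.En m (f ∘ S.sym σ) (g ∘ S.sym σ) = S.En m f g := by
  have hpol : ∀ a b : K → ℝ, S.En m (a + b) (a + b) = S.En m a a + 2 * S.En m a b + S.En m b b :=
    fun a b => by
      have := S.En_add_smul_self m 1 a b
      rw [one_smul] at this
      linarith
  have h1 := hpol f g
  have h2 := hpol (f ∘ S.sym σ) (g ∘ S.sym σ)
  have h3 : S.En m (f ∘ S.sym σ + g ∘ S.sym σ) (f ∘ S.sym σ + g ∘ S.sym σ) =
    S.En m (f + g) (f + g) := S.sym_E σ m (f + g)
  have h4 : S.En m (f ∘ S.sym σ) (f ∘ S.sym σ) = S.En m f f := S.sym_E σ m f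
  have h5 : S.En m (g ∘ S.sym σ) (g ∘ S.sym σ) = S.En m g g := S.sym_E σ m g
  linarith

theorem DomE.comp_sym {f : K → ℝ} (hf : S.DomE f) (σ : Equiv.Perm (Fin 3)) :
    S.DomE (f ∘ S.sym σ) := by
  refine ⟨hf.1.comp (S.sym σ).continuous, ?_⟩
  simp only [En_comp_sym]
  exact hf.2

theorem IsLap.comp_sym {f u : K → ℝ} (h : S.IsLap f u) (σ : Equiv.Perm (Fin 3)) :
    S.IsLap (f ∘ S.sym σ) (u ∘ S.sym σ) := by
  refine ⟨h.1.comp_sym σ, h.2.1.comp (S.sym σ).continuous, fun v hv hv0 => ?_⟩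
  have hv' : (v ∘ S.sym σ⁻¹) ∘ S.sym σ = v := by
    ext y
    simp only [Function.comp_apply, sym_mul_apply, inv_mul_cancel, sym_one_apply]
  have h1 := h.2.2 _ (hv.comp_sym σ⁻¹) fun l => by
    rw [Function.comp_apply, S.sym_q, hv0]
  have h2 : ∫ y, (u ∘ S.sym σ) y * v y ∂S.μ = ∫ y, u y * (v ∘ S.sym σ⁻¹) y ∂S.μ := by
    conv_rhs => rw [← S.sym_μ σ]
    rw [integral_map (f := fun y => u y * (v ∘ S.sym σ⁻¹) y) (S.sym σ).continuous.aemeasurable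
      (h.2.1.mul (hv.comp_sym σ⁻¹).1).aestronglyMeasurable]
    refine integral_congr_ae (Eventually.of_forall fun y => ?_)
    exact congrArg (u (S.sym σ y) * ·) (congrFun hv' y).symm
  rw [h2]
  refine h1.congr fun m => ?_
  conv_rhs => rw [← hv']
  rw [En_comp_sym]

theorem harmonic_domE (h : S.harmonic) : S.DomE h.1 := by
  refine ⟨h.1.continuous, S.En 0 h.1 h.1, ?_⟩
  rintro _ ⟨m, rfl⟩
  exact (S.En_harmonic h.2 m _).le

/-- The energy is a positively weighted sum of squared differences. This lets a harmonic function be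
turned into a test function in `exists_bump`. -/
theorem En_comp_lipschitz_le {φ : ℝ → ℝ} (hφ : ∀ a b, |φ a - φ b| ≤ |a - b|) (m : ℕ)
    (f : K → ℝ) : S.En m (φ ∘ f) (φ ∘ f) ≤ S.En m f f := by
  induction m generalizing f with
  | zero =>
    rw [En_zero_self, En_zero_self]
    exact add_le_add (add_le_add (sq_le_sq.2 (hφ _ _)) (sq_le_sq.2 (hφ _ _)))
      (sq_le_sq.2 (hφ _ _))
  | succ m ih =>
    exact Finset.sum_le_sum fun i _ =>
      mul_le_mul_of_nonneg_left (ih (f ∘ S.F i)) (inv_nonneg.2 (S.r_pos i).le)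

theorem integral_Fw_eq_zero {φ : K → ℝ} (hc : Continuous φ) (h0 : ∀ y, 0 ≤ φ y)
    (hi : ∫ y, φ y ∂S.μ = 0) (w : List (Fin S.N)) : ∫ y, φ (S.Fw w y) ∂S.μ = 0 := by
  induction w generalizing φ with
  | nil => exact hi
  | cons i w ih =>
    refine ih (φ := φ ∘ S.F i) (hc.comp (S.continuous_F i)) (fun y => h0 _) ?_
    rw [S.integral_eq_sum hc] at hi
    have h1 := (Finset.sum_eq_zero_iff_of_nonneg fun j _ => mul_nonneg (S.wt_pos j).le
      (integral_nonneg fun y => h0 (S.F j y))).1 hi i (Finset.mem_univ i)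
    exact (mul_eq_zero.1 h1).resolve_left (S.wt_pos i).ne'

theorem integral_ge_of_le {φ : K → ℝ} (hc : Continuous φ) {c : ℝ} (h : ∀ y, c ≤ φ y) :
    c ≤ ∫ y, φ y ∂S.μ := by
  have := S.μ_prob
  have h1 : ∫ _, c ∂S.μ ≤ ∫ y, φ y ∂S.μ := integral_mono (integrable_const c)
    (hc.integrable_of_hasCompactSupport (HasCompactSupport.of_compactSpace _)) h
  simpa using h1

/-- A continuous function is close to its value at `y` on a small cell that contains `y`. -/
theorem exists_cell_close {φ : K → ℝ} (hc : Continuous φ) (y : K) {ε : ℝ} (hε : 0 < ε) :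
    ∃ w : List (Fin S.N), ∀ z, |φ (S.Fw w z) - φ y| < ε := by
  obtain ⟨δ, hδ, h⟩ := Metric.continuousAt_iff.1 (hc.continuousAt (x := y)) ε hε
  obtain ⟨m, hm⟩ := S.cell_dist_lt hδ
  obtain ⟨w, hw, y', rfl⟩ := S.exists_word m y
  exact ⟨w, fun z => h (hm w hw _ _)⟩

/-- A zero integral would pass to every cell by self-similarity, but `φ` is at least `φ y / 2` on a
small cell containing `y`. -/
theorem integral_pos_of_nonneg {φ : K → ℝ} (hc : Continuous φ) (h0 : ∀ y, 0 ≤ φ y) {y : K}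
    (hy : 0 < φ y) : 0 < ∫ z, φ z ∂S.μ := by
  refine lt_of_le_of_ne (integral_nonneg h0) fun h => ?_
  obtain ⟨w, hw⟩ := exists_cell_close (S := S) hc y (half_pos hy)
  have h1 := integral_ge_of_le (S := S) (hc.comp (S.Fw_continuous w)) (c := φ y / 2) fun z => by
    have := (abs_lt.1 (hw z)).1
    change _ ≤ φ (S.Fw w z)
    linarith
  have h2 := integral_Fw_eq_zero hc h0 h.symm w
  have h3 : ∫ z, (φ ∘ S.Fw w) z ∂S.μ = 0 := h2
  linarith

variable (S) in
/-- There is a nonnegative test function with positive integral. -/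
theorem exists_bump : ∃ v, S.IsTest v ∧ (∀ y, 0 ≤ v y) ∧ 0 < ∫ y, v y ∂S.μ := by
  obtain ⟨h, hh⟩ := S.exists_harmonic_extension ![1, 0, 0]
  have h0 : h.1 (S.q 0) = 1 := hh 0
  have h1 : h.1 (S.q 1) = 0 := hh 1
  have h2 : h.1 (S.q 2) = 0 := hh 2
  -- `φ` is 1-Lipschitz, vanishes at the boundary values `0` and `1` of `h`, and is positive at
  -- `1/2`, a value `h` takes since `K` is connected.
  set φ : ℝ → ℝ := fun t => max 0 (min t (1 - t)) with hφ
  have hφc : Continuous φ := by fun_prop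
  have hlip : ∀ a b, |φ a - φ b| ≤ |a - b| := fun a b => by
    refine (abs_max_sub_max_le_max 0 _ 0 _).trans ?_
    rw [sub_self, abs_zero, max_eq_right (abs_nonneg _)]
    refine (abs_min_sub_min_le_max _ _ _ _).trans (max_le le_rfl ?_)
    rw [sub_sub_sub_cancel_left, abs_sub_comm]
  have htest : S.IsTest (φ ∘ h.1) := by
    refine ⟨⟨hφc.comp h.1.continuous, ?_⟩, fun l => ?_⟩
    · obtain ⟨B, hB⟩ := (harmonic_domE h).2
      refine ⟨B, ?_⟩
      rintro _ ⟨m, rfl⟩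
      exact (En_comp_lipschitz_le hlip m _).trans (hB ⟨m, rfl⟩)
    · fin_cases l
      · change φ (h.1 (S.q 0)) = 0
        simp [h0, hφ]
      · change φ (h.1 (S.q 1)) = 0
        simp [h1, hφ]
      · change φ (h.1 (S.q 2)) = 0
        simp [h2, hφ]
  obtain ⟨y, hy⟩ : (1 / 2 : ℝ) ∈ Set.range h.1 :=
    mem_range_of_exists_le_of_exists_ge h.1.continuous ⟨S.q 1, by rw [h1]; norm_num⟩
      ⟨S.q 0, by rw [h0]; norm_num⟩
  refine ⟨_, htest, fun y => le_max_left _ _, ?_⟩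
  refine integral_pos_of_nonneg htest.1.1 (fun y => le_max_left _ _) (y := y) ?_
  rw [Function.comp_apply, hy]
  norm_num [hφ]

/-- Orthogonality to all test functions passes to `u ∘ F_w`. Where `u` is positive it is bounded
below on a small cell, so a bump there has a positive pairing with it. -/
theorem eq_zero_of_orthogonal {u : K → ℝ} (hc : Continuous u)
    (h : ∀ v, S.IsTest v → ∫ y, u y * v y ∂S.μ = 0) : u = 0 := by
  obtain ⟨v, hv, hv0, hpos⟩ := S.exists_bump
  have hcell : ∀ (w : List (Fin S.N)) (u : K → ℝ), Continuous u →
      (∀ v, S.IsTest v → ∫ y, u y * v y ∂S.μ = 0) → ∫ y, u (S.Fw w y) * v y ∂S.μ = 0 := by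
    intro w
    induction w with
    | nil => exact fun u _ h => h v hv
    | cons i w ih =>
      intro u hc h
      refine ih (u ∘ S.F i) (hc.comp (S.continuous_F i)) fun v' hv' => ?_
      have := h _ (hv'.cellExt i)
      rw [integral_mul_cellExt hc hv'] at this
      exact (mul_eq_zero.1 this).resolve_left (S.wt_pos i).ne'
  have hle : ∀ u : K → ℝ, Continuous u → (∀ v, S.IsTest v → ∫ y, u y * v y ∂S.μ = 0) →
      ∀ y, u y ≤ 0 := by
    intro u hc h y
    by_contra! hy
    obtain ⟨w, hw⟩ := exists_cell_close (S := S) hc y (half_pos hy)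
    have h1 := hcell w u hc h
    have h2 : ∫ z, u y / 2 * v z ∂S.μ ≤ ∫ z, u (S.Fw w z) * v z ∂S.μ :=
      integral_mono (S.integrable_mul continuous_const hv.1.1)
        (S.integrable_mul (hc.comp (S.Fw_continuous w)) hv.1.1) fun z =>
        mul_le_mul_of_nonneg_right (by linarith [(abs_lt.1 (hw z)).1]) (hv0 z)
    rw [integral_const_mul, h1] at h2
    linarith [mul_pos (half_pos hy) hpos]
  ext y
  refine le_antisymm (hle u hc h y) ?_
  have := hle (-u) hc.neg (fun v hv => by simp [integral_neg, h v hv]) y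
  exact neg_nonpos.1 this

theorem IsLap.unique {f u u' : K → ℝ} (h : S.IsLap f u) (h' : S.IsLap f u') : u = u' := by
  refine sub_eq_zero.1 (eq_zero_of_orthogonal (S := S) (h.2.1.sub h'.2.1) fun v hv => ?_)
  have := tendsto_nhds_unique (h.2.2 v hv.1 hv.2) (h'.2.2 v hv.1 hv.2)
  simp only [Pi.sub_apply, sub_mul]
  rw [integral_sub (S.integrable_mul h.2.1 hv.1.1) (S.integrable_mul h'.2.1 hv.1.1)]
  linarith

/-- Subtract the harmonic function with the same boundary values. The difference is a test function
whose energies increase to `0`, so it is constant and hence zero. -/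
theorem IsLap.exists_harmonic {f : K → ℝ} (hf : S.IsLap f 0) :
    ∃ h : S.harmonic, (h.1 : K → ℝ) = f := by
  obtain ⟨h, hh⟩ := S.exists_harmonic_extension (f ∘ S.q)
  refine ⟨h, ?_⟩
  set v : K → ℝ := f + (-1 : ℝ) • (h.1 : K → ℝ) with hvdef
  have hv : S.IsTest v := by
    refine ⟨hf.1.add ((harmonic_domE h).smul (-1)), fun l => ?_⟩
    change f (S.q l) + (-1) * h.1 (S.q l) = 0
    rw [hh, Function.comp_apply]
    ring
  have hhv : ∀ m, S.En m h.1 v = 0 := fun m => by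
    rw [S.En_harmonic h.2, S.En_congr (fun _ _ => rfl) (g' := 0), En_zero_right]
    rintro _ ⟨w, hw, l, rfl⟩
    rw [List.length_eq_zero_iff.1 hw]
    exact hv.2 l
  have hlim : Tendsto (fun m => S.En m v v) atTop (𝓝 0) := by
    have := hf.2.2 v hv.1 hv.2
    simp only [Pi.zero_apply, zero_mul, integral_zero, neg_zero] at this
    refine this.congr fun m => ?_
    conv_rhs => rw [hvdef]
    rw [← hvdef, En_add_left, En_smul_left, hhv, mul_zero, add_zero]
  have hzero : ∀ m, S.En m v v = 0 := fun m =>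
    le_antisymm ((monotone_nat_of_le_succ fun m => S.En_mono m v).ge_of_tendsto hlim m)
      (S.En_nonneg m v)
  ext y
  have h1 := S.eq_of_En_eq_zero hv.1.1 hzero y
  rw [hv.2] at h1
  change f y + (-1) * h.1 y = 0 at h1
  linarith

theorem IsIterLap.split {i j : ℕ} {f u : K → ℝ} (h : S.IsIterLap (i + j) f u) :
    ∃ v, S.IsIterLap i f v ∧ S.IsIterLap j v u := by
  induction i generalizing f with
  | zero =>
    rw [zero_add] at h
    exact ⟨f, rfl, h⟩
  | succ i ih =>
    rw [Nat.succ_add] at h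
    obtain ⟨g, hg, hgu⟩ := h
    obtain ⟨v, hv, hvu⟩ := ih hgu
    exact ⟨v, ⟨g, hg, hv⟩, hvu⟩

theorem IsIterLap.isLap {f u : K → ℝ} (h : S.IsIterLap 1 f u) : S.IsLap f u := by
  obtain ⟨v, hv, huv⟩ := h
  obtain rfl : u = v := huv
  exact hv

theorem IsIterLap.unique {i : ℕ} {f u u' : K → ℝ} (h : S.IsIterLap i f u)
    (h' : S.IsIterLap i f u') : u = u' := by
  induction i generalizing f with
  | zero => exact Eq.trans (b := f) h h'.symm
  | succ i ih =>
    obtain ⟨v, hv, hu⟩ := h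
    obtain ⟨v', hv', hu'⟩ := h'
    obtain rfl := hv.unique hv'
    exact ih hu hu'

theorem IsIterLap.comp_F {i : ℕ} {f u : K → ℝ} (h : S.IsIterLap i f u) (j : Fin S.N) :
    S.IsIterLap i (f ∘ S.F j) ((S.r j * S.wt j) ^ i • (u ∘ S.F j)) := by
  induction i generalizing f with
  | zero =>
    obtain rfl : u = f := h
    rw [pow_zero, one_smul]
    rfl
  | succ i ih =>
    obtain ⟨v, hv, hvu⟩ := h
    refine ⟨_, hv.comp_F j, ?_⟩
    have := (ih hvu).smul (S.r j * S.wt j)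
    rwa [smul_smul, ← pow_succ'] at this

theorem IsIterLap.comp_sym {i : ℕ} {f u : K → ℝ} (h : S.IsIterLap i f u)
    (σ : Equiv.Perm (Fin 3)) : S.IsIterLap i (f ∘ S.sym σ) (u ∘ S.sym σ) := by
  induction i generalizing f with
  | zero => exact congrArg (· ∘ S.sym σ) h
  | succ i ih =>
    obtain ⟨v, hv, hvu⟩ := h
    exact ⟨_, hv.comp_sym σ, ih hvu⟩

theorem IsIterLap.sum {ι : Type*} (s : Finset ι) {i : ℕ} {f u : ι → K → ℝ}
    (h : ∀ j ∈ s, S.IsIterLap i (f j) (u j)) :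
    S.IsIterLap i (∑ j ∈ s, f j) (∑ j ∈ s, u j) := by
  classical
  induction s using Finset.induction_on with
  | empty =>
    rw [Finset.sum_empty, Finset.sum_empty]
    exact IsIterLap.zero S i
  | insert a s ha ih =>
    rw [Finset.sum_insert ha, Finset.sum_insert ha]
    exact (h a (Finset.mem_insert_self a s)).add
      (ih fun j hj => h j (Finset.mem_insert_of_mem hj))

end D3Fractal

/-! ### Normal and transverse derivatives of multiharmonic functions at a boundary point. -/

/-- Solution of a scalar linear recurrence with exponential inhomogeneity. -/
theorem exists_eq_sum_pow_of_recurrence {b : ℕ → ℝ} {κ : ℝ} {n : ℕ} {α c : ℕ → ℝ}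
    (hne : ∀ k < n, c k ≠ κ)
    (hb : ∀ m, b (m + 1) = κ * b m + ∑ k ∈ Finset.range n, α k * c k ^ m) :
    ∃ e, ∀ m, b m = e * κ ^ m + ∑ k ∈ Finset.range n, α k / (c k - κ) * c k ^ m := by
  refine ⟨b 0 - ∑ k ∈ Finset.range n, α k / (c k - κ), fun m => ?_⟩
  induction m with
  | zero => simp
  | succ m ih =>
    rw [hb, ih, mul_add, pow_succ, Finset.mul_sum, add_assoc, ← Finset.sum_add_distrib]
    congr 1
    · ring
    · refine Finset.sum_congr rfl fun k hk => ?_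
      have := sub_ne_zero.2 (hne k (Finset.mem_range.1 hk))
      field_simp
      ring

namespace D3Fractal

variable {K : Type*} [MetricSpace K] [CompactSpace K] [ConnectedSpace K]
  [MeasurableSpace K] [BorelSpace K] (S : D3Fractal K)

/-- The Laplacian scaling factor `r_i μ_i`, which does not depend on `i`. -/
noncomputable def scale : ℝ := S.r (S.bd 0) * S.wt (S.bd 0)

theorem r_mul_wt_eq (i : Fin S.N) : S.r i * S.wt i = S.scale := S.r_mul_wt _ _

theorem scale_pos : 0 < S.scale := mul_pos (S.r_pos _) (S.wt_pos _)

theorem scale_lt_one : S.scale < 1 := by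
  have hwt : S.wt (S.bd 0) ≤ 1 := by
    rw [← S.wt_sum]
    exact Finset.single_le_sum (fun i _ => (S.wt_pos i).le) (Finset.mem_univ _)
  exact (mul_le_of_le_one_right (S.r_pos _).le hwt).trans_lt (S.r_lt_one _)

/-- Only the length of the word matters, so `Δ^i` scales alike on all cells of `U(x)`. -/
theorem rWord_mul_wtWord (w : List (Fin S.N)) :
    S.rWord w * S.wtWord w = S.scale ^ w.length := by
  induction w with
  | nil => simp [rWord, wtWord]
  | cons i w ih =>
    have h1 : S.rWord (i :: w) = S.r i * S.rWord w := by simp [rWord]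
    have h2 : S.wtWord (i :: w) = S.wt i * S.wtWord w := by simp [wtWord]
    rw [h1, h2, mul_mul_mul_comm, r_mul_wt_eq, ih, List.length_cons, pow_succ']

theorem rWord_pos (w : List (Fin S.N)) : 0 < S.rWord w := by
  refine List.prod_pos fun a ha => ?_
  obtain ⟨i, -, rfl⟩ := List.mem_map.1 ha
  exact S.r_pos i

/-- The difference quotient numerators of the normal derivative at `q l`. -/
def normalDiff (l : Fin 3) (f : K → ℝ) (m : ℕ) : ℝ :=
  2 * f (S.q l) - f ((S.F (S.bd l))^[m] (S.q (l + 1))) - f ((S.F (S.bd l))^[m] (S.q (l - 1)))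

/-- The difference quotient numerators of the transverse derivative at `q l`. -/
def transverseDiff (l : Fin 3) (f : K → ℝ) (m : ℕ) : ℝ :=
  f ((S.F (S.bd l))^[m] (S.q (l + 1))) - f ((S.F (S.bd l))^[m] (S.q (l - 1)))

theorem refl_iterate (l : Fin 3) (m : ℕ) (y : K) :
    S.refl l ((S.F (S.bd l))^[m] y) = (S.F (S.bd l))^[m] (S.refl l y) := by
  induction m with
  | zero => rfl
  | succ m ih => rw [Function.iterate_succ_apply', refl_F, ih, Function.iterate_succ_apply']

theorem rot_iterate (i l : Fin 3) (m : ℕ) (y : K) :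
    S.rot i ((S.F (S.bd l))^[m] y) = (S.F (S.bd (l + i)))^[m] (S.rot i y) := by
  induction m with
  | zero => rfl
  | succ m ih => rw [Function.iterate_succ_apply', rot_F, ih, Function.iterate_succ_apply']

theorem normalDiff_refl (l : Fin 3) (f : K → ℝ) (m : ℕ) :
    S.normalDiff l (f ∘ S.refl l) m = S.normalDiff l f m := by
  simp only [normalDiff, Function.comp_apply, refl_iterate, refl_q, refl_q_add, refl_q_sub]
  ring

theorem transverseDiff_refl (l : Fin 3) (f : K → ℝ) (m : ℕ) :
    S.transverseDiff l (f ∘ S.refl l) m = -S.transverseDiff l f m := by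
  simp only [transverseDiff, Function.comp_apply, refl_iterate, refl_q_add, refl_q_sub]
  ring

theorem normalDiff_rot (i l : Fin 3) (f : K → ℝ) (m : ℕ) :
    S.normalDiff l (f ∘ S.rot i) m = S.normalDiff (l + i) f m := by
  simp only [normalDiff, Function.comp_apply, rot_iterate, rot_q, add_right_comm,
    sub_add_eq_add_sub]

theorem transverseDiff_rot (i l : Fin 3) (f : K → ℝ) (m : ℕ) :
    S.transverseDiff l (f ∘ S.rot i) m = S.transverseDiff (l + i) f m := by
  simp only [transverseDiff, Function.comp_apply, rot_iterate, rot_q, add_right_comm,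
    sub_add_eq_add_sub]

theorem harmonic_normalDiff (l : Fin 3) (h : S.harmonic) (m : ℕ) :
    S.normalDiff l h.1 m = S.rb ^ m * S.normalDiff l h.1 0 := by
  have key : ∀ h : S.harmonic, S.normalDiff 0 h.1 m = S.rb ^ m * S.normalDiff 0 h.1 0 := by
    induction m with
    | zero => intro h; rw [pow_zero, one_mul]
    | succ m ih =>
      intro h
      have h1 : S.normalDiff 0 h.1 (m + 1) = S.normalDiff 0 (S.M 0 h).1 m := by
        simp only [normalDiff, Function.iterate_succ_apply']
        change _ = 2 * h.1 (S.F (S.bd 0) (S.q 0)) - _ - _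
        rw [S.F_bd]
        rfl
      rw [h1, ih, pow_succ, mul_assoc]
      exact congrArg _ (S.flux_M h)
  have h1 := key (S.harmonicComp (Equiv.addRight l) h)
  have h2 : ∀ m, S.normalDiff 0 (S.harmonicComp (Equiv.addRight l) h).1 m =
      S.normalDiff l h.1 m := fun m => by
    refine (S.normalDiff_rot l 0 h.1 m).trans ?_
    rw [zero_add]
  rwa [h2, h2] at h1

theorem harmonic_transverseDiff (l : Fin 3) (h : S.harmonic) (m : ℕ) :
    S.transverseDiff l h.1 m = S.lam ^ m * S.transverseDiff l h.1 0 := by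
  have key : ∀ h : S.harmonic,
      S.transverseDiff 0 h.1 m = S.lam ^ m * S.transverseDiff 0 h.1 0 := by
    induction m with
    | zero => intro h; rw [pow_zero, one_mul]
    | succ m ih =>
      intro h
      have h1 : S.transverseDiff 0 h.1 (m + 1) = S.transverseDiff 0 (S.M 0 h).1 m := by
        simp only [transverseDiff, Function.iterate_succ_apply']
        rfl
      rw [h1, ih, pow_succ, mul_assoc]
      exact congrArg _ (S.transverse_M h)
  have h1 := key (S.harmonicComp (Equiv.addRight l) h)
  have h2 : ∀ m, S.transverseDiff 0 (S.harmonicComp (Equiv.addRight l) h).1 m =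
      S.transverseDiff l h.1 m := fun m => by
    refine (S.transverseDiff_rot l 0 h.1 m).trans ?_
    rw [zero_add]
  rwa [h2, h2] at h1

variable {S}

/-- `Δ^i` commutes with the reflection and is single valued. -/
theorem IsIterLap.odd {i : ℕ} {f u : K → ℝ} (h : S.IsIterLap i f u) {l : Fin 3}
    (ho : ∀ y, f (S.refl l y) = -f y) (y : K) : u (S.refl l y) = -u y := by
  have h1 := h.comp_sym (Equiv.swap (l + 1) (l - 1))
  have h2 : f ∘ S.sym (Equiv.swap (l + 1) (l - 1)) = (-1 : ℝ) • f := by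
    ext z
    exact (ho z).trans (by simp)
  rw [h2] at h1
  refine (congrFun (h1.unique (h.smul (-1))) y).trans (by simp)

/-- On odd multiharmonic functions the values along the orbit of a point under `F l` are
combinations of the powers of `lam * scale ^ k`. -/
theorem exists_orbit_expansion (hlam : S.lam ≠ 0) (l : Fin 3) (p : K) (n : ℕ) {f : K → ℝ}
    (hf : S.IsIterLap (n + 1) f 0) (ho : ∀ y, f (S.refl l y) = -f y) :
    ∃ α : ℕ → ℝ, ∀ m, f ((S.F (S.bd l))^[m] p) =
      ∑ k ∈ Finset.range (n + 1), α k * (S.lam * S.scale ^ k) ^ m := by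
  have hharm : ∀ u : K → ℝ, S.IsLap u 0 → (∀ y, u (S.refl l y) = -u y) → ∀ y,
      u (S.F (S.bd l) y) = S.lam * u y := by
    intro u hu hou y
    obtain ⟨h, rfl⟩ := hu.exists_harmonic
    exact DFunLike.congr_fun (congrArg Subtype.val (S.M_odd hou)) y
  induction n generalizing f with
  | zero =>
    refine ⟨fun _ => f p, fun m => ?_⟩
    rw [Finset.sum_range_one, pow_zero, mul_one]
    induction m with
    | zero => simp
    | succ m ih =>
      rw [Function.iterate_succ_apply', hharm f hf.isLap ho, ih]
      ring
  | succ n ih =>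
    -- `v = Δ^(n+1) f` is odd and harmonic, so `Δ^(n+1)` sends `f ∘ F_l` to `κ v`. Hence `f ∘ F_l -
    -- κ f` is multiharmonic of one order less.
    set κ := S.lam * S.scale ^ (n + 1) with hκ
    obtain ⟨v, hfv, hv⟩ := hf.split (i := n + 1) (j := 1)
    have hvF := hharm v hv.isLap (hfv.odd ho)
    have hg := (hfv.comp_F (S.bd l)).add (hfv.smul (-κ))
    have hz : (S.r (S.bd l) * S.wt (S.bd l)) ^ (n + 1) • (v ∘ S.F (S.bd l)) + (-κ) • v = 0 := by
      ext y
      simp only [Pi.add_apply, Pi.smul_apply, Function.comp_apply, smul_eq_mul, hvF,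
        S.r_mul_wt_eq, hκ, Pi.zero_apply]
      ring
    rw [hz] at hg
    obtain ⟨α, hα⟩ := ih hg fun y => by
      simp only [Pi.add_apply, Pi.smul_apply, Function.comp_apply, smul_eq_mul]
      rw [← refl_F, ho, ho]
      ring
    -- There is no resonance: the powers of `scale`, which lies strictly between `0` and `1`, are
    -- distinct, and `lam ≠ 0`.
    obtain ⟨e, he⟩ := exists_eq_sum_pow_of_recurrence (b := fun m => f ((S.F (S.bd l))^[m] p))
      (κ := κ) (n := n + 1) (α := α) (c := fun k => S.lam * S.scale ^ k) (fun k hk h => by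
        have := pow_right_injective₀ S.scale_pos S.scale_lt_one.ne (mul_left_cancel₀ hlam h)
        omega) fun m => by
          have := hα m
          simp only [Pi.add_apply, Pi.smul_apply, Function.comp_apply, smul_eq_mul] at this
          rw [← this, Function.iterate_succ_apply']
          ring
    refine ⟨fun k => if k = n + 1 then e else α k / (S.lam * S.scale ^ k - κ), fun m => ?_⟩
    rw [Finset.sum_range_succ]
    refine (he m).trans ?_
    rw [add_comm]
    simp only [if_pos, ← hκ]
    congr 1
    refine Finset.sum_congr rfl fun k hk => ?_
    rw [if_neg (Finset.mem_range.1 hk).ne]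

/-- The transverse derivatives of multiharmonic functions exist. -/
theorem exists_transverse_limit (hlam : S.lam ≠ 0) (l : Fin 3) {n : ℕ} {f : K → ℝ}
    (hf : S.IsIterLap (n + 1) f 0) :
    ∃ d, Tendsto (fun m => (S.lam ^ m)⁻¹ * S.transverseDiff l f m) atTop (𝓝 d) := by
  -- The odd part `f - f ∘ refl l`, evaluated along the orbit of `q (l + 1)`, is the transverse
  -- difference of `f`.
  have hg := hf.add ((hf.comp_sym (Equiv.swap (l + 1) (l - 1))).smul (-1))
  have hz : (0 : K → ℝ) + (-1 : ℝ) • ((0 : K → ℝ) ∘ S.sym (Equiv.swap (l + 1) (l - 1))) = 0 := by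
    ext y
    simp
  rw [hz] at hg
  obtain ⟨α, hα⟩ := exists_orbit_expansion hlam l (S.q (l + 1)) n hg fun y => by
    change f (S.refl l y) + (-1) * f (S.refl l (S.refl l y)) =
      -(f y + (-1) * f (S.refl l y))
    rw [refl_refl]
    ring
  have hpow : ∀ k, ∃ c, Tendsto (fun m : ℕ => (S.scale ^ k) ^ m) atTop (𝓝 c) := fun k => by
    rcases eq_or_ne k 0 with rfl | hk
    · exact ⟨1, by simp⟩
    · exact ⟨0, tendsto_pow_atTop_nhds_zero_of_lt_one (pow_nonneg S.scale_pos.le k)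
        (pow_lt_one₀ S.scale_pos.le S.scale_lt_one hk)⟩
  choose c hc using hpow
  refine ⟨_, (tendsto_finsetSum (Finset.range (n + 1)) fun k _ =>
    (hc k).const_mul (α k)).congr fun m => ?_⟩
  have h1 : S.transverseDiff l f m = f ((S.F (S.bd l))^[m] (S.q (l + 1))) +
      (-1) * f (S.refl l ((S.F (S.bd l))^[m] (S.q (l + 1)))) := by
    rw [refl_iterate, refl_q_add, transverseDiff]
    ring
  rw [h1]
  have h2 := hα m
  change f _ + (-1) * f (S.refl l _) = _ at h2
  rw [h2, Finset.mul_sum]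
  refine Finset.sum_congr rfl fun k _ => ?_
  rw [mul_pow, mul_left_comm, inv_mul_cancel_left₀ (pow_ne_zero m hlam)]

/-- For harmonic functions both difference quotients are constant in `m`, so their limits already
determine the boundary values. -/
theorem harmonic_eq_zero_of_jet (hlam : S.lam ≠ 0) (l : Fin 3) (h : S.harmonic)
    (h0 : h.1 (S.q l) = 0)
    (hn : Tendsto (fun m => (S.rb ^ m)⁻¹ * S.normalDiff l h.1 m) atTop (𝓝 0))
    (ht : Tendsto (fun m => (S.lam ^ m)⁻¹ * S.transverseDiff l h.1 m) atTop (𝓝 0)) : h = 0 := by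
  have hr : S.rb ≠ 0 := (S.r_pos _).ne'
  have h1 : S.normalDiff l h.1 0 = 0 := by
    refine tendsto_nhds_unique (tendsto_const_nhds.congr fun m => ?_) hn
    rw [S.harmonic_normalDiff l h m, inv_mul_cancel_left₀ (pow_ne_zero m hr)]
  have h2 : S.transverseDiff l h.1 0 = 0 := by
    refine tendsto_nhds_unique (tendsto_const_nhds.congr fun m => ?_) ht
    rw [S.harmonic_transverseDiff l h m, inv_mul_cancel_left₀ (pow_ne_zero m hlam)]
  simp only [normalDiff, Function.iterate_zero, id_eq, h0] at h1
  simp only [transverseDiff, Function.iterate_zero, id_eq] at h2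
  refine S.harmonic_eq_zero fun k => ?_
  have hk : ∀ k l : Fin 3, k = l ∨ k = l + 1 ∨ k = l - 1 := by decide
  rcases hk k l with rfl | rfl | rfl
  · exact h0
  · linarith
  · linarith

/-- A multiharmonic function with vanishing jet at a boundary point is zero. -/
theorem eq_zero_of_jet (hlam : S.lam ≠ 0) (l : Fin 3) (n : ℕ) {f : K → ℝ}
    (hf : S.IsIterLap (n + 1) f 0)
    (hjet : ∀ i ≤ n, ∃ u, S.IsIterLap i f u ∧ u (S.q l) = 0 ∧
      Tendsto (fun m => (S.rb ^ m)⁻¹ * S.normalDiff l u m) atTop (𝓝 0) ∧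
      Tendsto (fun m => (S.lam ^ m)⁻¹ * S.transverseDiff l u m) atTop (𝓝 0)) : f = 0 := by
  have hharm : ∀ f : K → ℝ, S.IsLap f 0 → (∃ u, S.IsIterLap 0 f u ∧ u (S.q l) = 0 ∧
      Tendsto (fun m => (S.rb ^ m)⁻¹ * S.normalDiff l u m) atTop (𝓝 0) ∧
      Tendsto (fun m => (S.lam ^ m)⁻¹ * S.transverseDiff l u m) atTop (𝓝 0)) → f = 0 := by
    rintro f hf0 ⟨u, hu, h0, h1, h2⟩
    obtain ⟨h, rfl⟩ := hf0.exists_harmonic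
    obtain rfl : u = h.1 := hu
    rw [harmonic_eq_zero_of_jet hlam l h h0 h1 h2]
    rfl
  induction n generalizing f with
  | zero => exact hharm f hf.isLap (hjet 0 le_rfl)
  | succ n ih =>
    obtain ⟨v, hfv, hv⟩ := hf
    -- The jet of `Δ f` is that of `f` shifted by one order, so induction makes `f` harmonic.
    have hv0 : v = 0 := ih hv fun i hi => by
      obtain ⟨u, ⟨v', hv', hu⟩, hu'⟩ := hjet (i + 1) (Nat.succ_le_succ hi)
      obtain rfl := hfv.unique hv'
      exact ⟨u, hu, hu'⟩
    exact hharm f (hv0 ▸ hfv) (hjet 0 (Nat.zero_le _))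

end D3Fractal

/-! ### Functions on `U(x)`: gluing, reflection and rotation average. -/

namespace D3Fractal

variable {K : Type*} [MetricSpace K] [CompactSpace K] [ConnectedSpace K]
  [MeasurableSpace K] [BorelSpace K] {S : D3Fractal K} {x : K}

theorem Fw_idx (w : S.W x) : S.Fw w.1 (S.q (S.idx w)) = x := (S.exists_idx w).choose_spec

theorem toU_idx (w : S.W x) : S.toU w (S.q (S.idx w)) = S.center x := Subtype.ext (Fw_idx w)

/-- `U` is built from cells containing `x`, `W` from cells having `x` as a vertex. They agree
because distinct cells of one level meet only at vertices. -/
theorem exists_W_of_mem (hx : x ∈ S.Vstar) {w : List (Fin S.N)} (hw : w.length = S.level x)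
    (hxw : x ∈ Set.range (S.Fw w)) : ∃ w' : S.W x, w'.1 = w := by
  classical
  have hl : x ∈ S.V (S.level x) := Nat.sInf_mem (s := {m | x ∈ S.V m}) (Set.mem_iUnion.1 hx)
  obtain ⟨w₁, hw₁, l₁, h₁⟩ := hl
  have : ∃ l, S.Fw w (S.q l) = x := by
    rcases eq_or_ne w w₁ with rfl | hne
    · exact ⟨l₁, h₁⟩
    · obtain ⟨l, -, h, -⟩ := S.exists_vertex_of_meet (hw.trans hw₁.symm) hxw ⟨_, h₁⟩ hne
      exact ⟨l, h⟩
  refine ⟨⟨w, ?_⟩, rfl⟩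
  rw [PCFStructure.W, Finset.mem_filter, Set.Finite.mem_toFinset]
  exact ⟨hw, this⟩

theorem exists_toU (hx : x ∈ S.Vstar) (y : S.U x) : ∃ (w : S.W x) (z : K), S.toU w z = y := by
  obtain ⟨w, ⟨hw, hxw⟩, z, hz⟩ := Set.mem_iUnion₂.1 y.2
  obtain ⟨w', rfl⟩ := exists_W_of_mem hx hw hxw
  exact ⟨w', z, Subtype.ext hz⟩

theorem ext_toU (hx : x ∈ S.Vstar) {β : Type*} {G G' : S.U x → β}
    (h : ∀ w z, G (S.toU w z) = G' (S.toU w z)) : G = G' := by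
  ext y
  obtain ⟨w, z, rfl⟩ := exists_toU hx y
  exact h w z

/-- Functions on the cells around `x` that agree at `x` fit together. -/
theorem exists_glue (hx : x ∈ S.Vstar)
    (hcell : ∀ w w' : S.W x, w ≠ w' → Set.range (S.Fw w.1) ∩ Set.range (S.Fw w'.1) = {x})
    {β : Type*} (φ : S.W x → K → β) (c : β) (hφ : ∀ w, φ w (S.q (S.idx w)) = c) :
    ∃ G : S.U x → β, ∀ w z, G (S.toU w z) = φ w z := by
  choose w z h using exists_toU (S := S) hx
  refine ⟨fun y => φ (w y) (z y), fun w' z' => ?_⟩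
  change φ (w (S.toU w' z')) (z (S.toU w' z')) = φ w' z'
  have h1 : S.Fw (w (S.toU w' z')).1 (z (S.toU w' z')) = S.Fw w'.1 z' :=
    congrArg Subtype.val (h (S.toU w' z'))
  generalize w (S.toU w' z') = v at *
  generalize z (S.toU w' z') = y at *
  rcases eq_or_ne v w' with rfl | hne
  · rw [S.Fw_injective _ h1]
  · have hy : S.Fw v.1 y = x := by
      have : S.Fw v.1 y ∈ Set.range (S.Fw v.1) ∩ Set.range (S.Fw w'.1) :=
        ⟨⟨y, rfl⟩, ⟨z', h1.symm⟩⟩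
      rwa [hcell v w' hne] at this
    rw [S.Fw_injective _ (hy.trans (Fw_idx v).symm),
      S.Fw_injective _ ((h1.symm.trans hy).trans (Fw_idx w').symm)]
    exact (hφ v).trans (hφ w').symm

theorem existsUnique_localReflection (hx : x ∈ S.Vstar)
    (hcell : ∀ w w' : S.W x, w ≠ w' → Set.range (S.Fw w.1) ∩ Set.range (S.Fw w'.1) = {x}) :
    ∃! g : S.U x → S.U x, S.IsLocalReflection x g := by
  obtain ⟨g, hg⟩ := exists_glue hx hcell (fun w z => S.toU w (S.refl (S.idx w) z)) (S.center x)
    fun w => by rw [refl_q, toU_idx]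
  exact ⟨g, hg, fun g' hg' => ext_toU hx fun w z => (hg' w z).trans (hg w z).symm⟩

variable (S x) in
/-- `A` is the weighted rotation average on all functions on `U(x)`. -/
def IsAverage (A : (S.U x → ℝ) →ₗ[ℝ] (S.U x → ℝ)) : Prop :=
  ∀ (h : S.U x → ℝ) (w : S.W x) (z : K),
    A h (S.toU w z) = (∑ w' : S.W x, (S.rWord w'.1)⁻¹)⁻¹ *
      ∑ w' : S.W x, (S.rWord w'.1)⁻¹ * h (S.toU w' (S.rot (S.idx w' - S.idx w) z))

theorem sum_rWord_inv_ne_zero (hx : x ∈ S.Vstar) : ∑ w : S.W x, (S.rWord w.1)⁻¹ ≠ 0 := by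
  obtain ⟨w, -⟩ := exists_toU hx (S.center x)
  exact (Finset.sum_pos (fun w _ => inv_pos.2 (S.rWord_pos w.1)) ⟨w, Finset.mem_univ w⟩).ne'

theorem toU_rot_idx (w w' : S.W x) :
    S.toU w' (S.rot (S.idx w' - S.idx w) (S.q (S.idx w))) = S.center x := by
  rw [rot_q, add_sub_cancel, toU_idx]

/-- The formulas on the cells all give `h x` at `x`, since the rotations carry `q (idx w)` to `q
(idx w')`, so they glue. `A` acts on all functions; it is restricted to `H_n(U(x))` once
`IsAverage.mem` is known. -/
theorem exists_isAverage (hx : x ∈ S.Vstar)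
    (hcell : ∀ w w' : S.W x, w ≠ w' → Set.range (S.Fw w.1) ∩ Set.range (S.Fw w'.1) = {x}) :
    ∃ A, S.IsAverage x A := by
  choose A hA using fun h : S.U x → ℝ => exists_glue hx hcell
    (fun w z => (∑ w' : S.W x, (S.rWord w'.1)⁻¹)⁻¹ *
      ∑ w' : S.W x, (S.rWord w'.1)⁻¹ * h (S.toU w' (S.rot (S.idx w' - S.idx w) z)))
    (h (S.center x)) fun w => by
      simp only [toU_rot_idx, ← Finset.sum_mul]
      rw [inv_mul_cancel_left₀ (sum_rWord_inv_ne_zero hx)]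
  refine ⟨⟨⟨A, fun h h' => ext_toU hx fun w z => ?_⟩, fun c h => ext_toU hx fun w z => ?_⟩, hA⟩
  · simp only [Pi.add_apply, hA, mul_add, Finset.sum_add_distrib]
  · simp only [Pi.smul_apply, hA, smul_eq_mul, RingHom.id_apply, Finset.mul_sum]
    exact Finset.sum_congr rfl fun _ _ => by ring

theorem hasNormalDeriv_iff {w : S.W x} {h : S.U x → ℝ} {d : ℝ} :
    S.HasNormalDeriv w h d ↔ Tendsto (fun m : ℕ => (S.rWord w.1)⁻¹ * (S.rb ^ m)⁻¹ *
      S.normalDiff (S.idx w) (h ∘ S.toU w) m) atTop (𝓝 d) := by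
  simp only [HasNormalDeriv, normalDiff, Function.comp_apply, toU_idx]

theorem hasTransverseDeriv_iff {w : S.W x} {h : S.U x → ℝ} {d : ℝ} :
    S.HasTransverseDeriv w h d ↔ Tendsto (fun m : ℕ => (S.rWord w.1)⁻¹ * (S.lam ^ m)⁻¹ *
      S.transverseDiff (S.idx w) (h ∘ S.toU w) m) atTop (𝓝 d) := Iff.rfl

theorem HasNormalDeriv.add {w : S.W x} {h h' : S.U x → ℝ} {d d' : ℝ}
    (H : S.HasNormalDeriv w h d) (H' : S.HasNormalDeriv w h' d') :
    S.HasNormalDeriv w (h + h') (d + d') :=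
  (Tendsto.add H H').congr fun m => by simp only [Pi.add_apply]; ring

theorem HasNormalDeriv.smul {w : S.W x} {h : S.U x → ℝ} {d : ℝ}
    (H : S.HasNormalDeriv w h d) (c : ℝ) : S.HasNormalDeriv w (c • h) (c * d) :=
  (Tendsto.const_mul c H).congr fun m => by simp only [Pi.smul_apply, smul_eq_mul]; ring

theorem HasTransverseDeriv.add {w : S.W x} {h h' : S.U x → ℝ} {d d' : ℝ}
    (H : S.HasTransverseDeriv w h d) (H' : S.HasTransverseDeriv w h' d') :
    S.HasTransverseDeriv w (h + h') (d + d') :=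
  (Tendsto.add H H').congr fun m => by simp only [Pi.add_apply]; ring

theorem HasTransverseDeriv.smul {w : S.W x} {h : S.U x → ℝ} {d : ℝ}
    (H : S.HasTransverseDeriv w h d) (c : ℝ) : S.HasTransverseDeriv w (c • h) (c * d) :=
  (Tendsto.const_mul c H).congr fun m => by simp only [Pi.smul_apply, smul_eq_mul]; ring

section Reflection

variable {g : S.U x → S.U x} (hg : S.IsLocalReflection x g)

include hg

theorem IsLocalReflection.comp_toU (h : S.U x → ℝ) (w : S.W x) :
    (h ∘ g) ∘ S.toU w = (h ∘ S.toU w) ∘ S.refl (S.idx w) :=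
  funext fun z => congrArg h (hg w z)

theorem IsLocalReflection.center (w : S.W x) : g (S.center x) = S.center x := by
  rw [← toU_idx w, hg, refl_q]

theorem HasNormalDeriv.comp_refl {w : S.W x} {h : S.U x → ℝ} {d : ℝ}
    (H : S.HasNormalDeriv w h d) : S.HasNormalDeriv w (h ∘ g) d := by
  rw [hasNormalDeriv_iff] at *
  simpa only [hg.comp_toU, normalDiff_refl] using H

theorem HasTransverseDeriv.comp_refl {w : S.W x} {h : S.U x → ℝ} {d : ℝ}
    (H : S.HasTransverseDeriv w h d) : S.HasTransverseDeriv w (h ∘ g) (-d) := by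
  rw [hasTransverseDeriv_iff] at *
  simpa only [hg.comp_toU, transverseDiff_refl, mul_neg] using H.neg

theorem IsLocalIterLap.comp_refl {i : ℕ} {h u : S.U x → ℝ} (H : S.IsLocalIterLap i h u) :
    S.IsLocalIterLap i (h ∘ g) (u ∘ g) := fun w => by
  rw [hg.comp_toU, hg.comp_toU]
  exact (H w).comp_sym _

theorem comp_refl_mem {n : ℕ} {h : S.U x → ℝ} (H : h ∈ S.localHarmonic n x) :
    h ∘ g ∈ S.localHarmonic n x := by
  refine ⟨fun w => ?_, fun i hi => ?_⟩
  · rw [hg.comp_toU]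
    exact IsIterLap.comp_sym (H.1 w) _
  · obtain ⟨u, hu, d, hd, hs⟩ := H.2 i hi
    exact ⟨u ∘ g, hu.comp_refl hg, d, fun w => (hd w).comp_refl hg, hs⟩

end Reflection

section Average

variable {A : (S.U x → ℝ) →ₗ[ℝ] (S.U x → ℝ)} (hA : S.IsAverage x A)

include hA

theorem IsAverage.comp_toU (h : S.U x → ℝ) (w : S.W x) :
    A h ∘ S.toU w = (∑ w' : S.W x, (S.rWord w'.1)⁻¹)⁻¹ •
      ∑ w' : S.W x, (S.rWord w'.1)⁻¹ • ((h ∘ S.toU w') ∘ S.rot (S.idx w' - S.idx w)) := by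
  ext z
  simp only [Function.comp_apply, hA h w z, Pi.smul_apply, Finset.sum_apply, smul_eq_mul]

theorem IsAverage.center (hx : x ∈ S.Vstar) (h : S.U x → ℝ) :
    A h (S.center x) = h (S.center x) := by
  obtain ⟨w, -⟩ := exists_toU hx (S.center x)
  conv_lhs => rw [← toU_idx w]
  rw [hA]
  simp only [toU_rot_idx, ← Finset.sum_mul]
  rw [inv_mul_cancel_left₀ (sum_rWord_inv_ne_zero hx)]

theorem IsAverage.isIterLap {i : ℕ} {h : S.U x → ℝ} {u : S.W x → K → ℝ}
    (H : ∀ w, S.IsIterLap i (h ∘ S.toU w) (u w)) (w : S.W x) :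
    S.IsIterLap i (A h ∘ S.toU w) ((∑ w' : S.W x, (S.rWord w'.1)⁻¹)⁻¹ •
      ∑ w' : S.W x, (S.rWord w'.1)⁻¹ • (u w' ∘ S.rot (S.idx w' - S.idx w))) := by
  rw [hA.comp_toU]
  exact (IsIterLap.sum _ fun w' _ => ((H w').comp_sym _).smul _).smul _

/-- The average mixes cells, so this needs the factor `(r_w μ_w)^i` to be the same for all `w`. -/
theorem IsAverage.isLocalIterLap {i : ℕ} {h u : S.U x → ℝ} (H : S.IsLocalIterLap i h u) :
    S.IsLocalIterLap i (A h) (A u) := fun w => by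
  have h1 := hA.isIterLap H w
  convert h1 using 1
  rw [hA.comp_toU]
  ext z
  simp only [rWord_mul_wtWord, S.length_eq, Pi.smul_apply, Finset.sum_apply, smul_eq_mul,
    Function.comp_apply, Finset.mul_sum]
  exact Finset.sum_congr rfl fun _ _ => by ring

/-- Rotation matches the difference quotients at `x` in different cells, and the weight `r_{w'}⁻¹`
is the one in `∂_n^{w'}`. The limit is a multiple of `∑ d w'`, which is zero. -/
theorem IsAverage.hasNormalDeriv {u : S.U x → ℝ} (H : S.Matching u) (w : S.W x) :
    S.HasNormalDeriv w (A u) 0 := by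
  obtain ⟨d, hd, hs⟩ := H
  rw [hasNormalDeriv_iff]
  have h1 := (tendsto_finsetSum Finset.univ fun w' _ =>
    hasNormalDeriv_iff.1 (hd w')).const_mul
      ((S.rWord w.1)⁻¹ * (∑ w' : S.W x, (S.rWord w'.1)⁻¹)⁻¹)
  rw [hs, mul_zero] at h1
  refine h1.congr fun m => ?_
  have h2 : S.normalDiff (S.idx w) (A u ∘ S.toU w) m =
      (∑ w' : S.W x, (S.rWord w'.1)⁻¹)⁻¹ * ∑ w' : S.W x, (S.rWord w'.1)⁻¹ *
        S.normalDiff (S.idx w) ((u ∘ S.toU w') ∘ S.rot (S.idx w' - S.idx w)) m := by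
    rw [hA.comp_toU]
    simp only [normalDiff, Pi.smul_apply, Finset.sum_apply, smul_eq_mul, mul_sub,
      Finset.sum_sub_distrib, Finset.mul_sum]
    congr 2
    exact Finset.sum_congr rfl fun _ _ => by ring
  rw [h2]
  simp only [normalDiff_rot, add_sub_cancel, Finset.mul_sum]
  exact Finset.sum_congr rfl fun _ _ => by ring

theorem IsAverage.mem {n : ℕ} {h : S.U x → ℝ} (H : h ∈ S.localHarmonic n x) :
    A h ∈ S.localHarmonic n x := by
  refine ⟨fun w => ?_, fun i hi => ?_⟩
  · have := hA.isIterLap H.1 w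
    have hz : ∀ σ : K ≃ₜ K, (0 : K → ℝ) ∘ σ = 0 := fun _ => rfl
    simp only [hz, smul_zero, Finset.sum_const_zero] at this
    exact this
  · obtain ⟨u, hu, hm⟩ := H.2 i hi
    exact ⟨A u, hA.isLocalIterLap hu, 0, hA.hasNormalDeriv hm, by simp⟩

end Average

/-! ### Jets at `x` and uniqueness. -/

theorem rWord_mul_wtWord_pow_ne_zero (w : List (Fin S.N)) (i : ℕ) :
    (S.rWord w * S.wtWord w) ^ i ≠ 0 := by
  rw [rWord_mul_wtWord]
  exact pow_ne_zero _ (pow_ne_zero _ S.scale_pos.ne')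

theorem IsLocalIterLap.unique (hx : x ∈ S.Vstar) {i : ℕ} {h u u' : S.U x → ℝ}
    (H : S.IsLocalIterLap i h u) (H' : S.IsLocalIterLap i h u') : u = u' :=
  ext_toU hx fun w z =>
    mul_left_cancel₀ (rWord_mul_wtWord_pow_ne_zero w.1 i) (congrFun ((H w).unique (H' w)) z)

/-- On each cell `u` is, up to a nonzero factor, the `i`-th Laplacian of `h`, hence annihilated by
the remaining `n + 1 - i`. -/
theorem exists_hasTransverseDeriv (hlam : S.lam ≠ 0) {n i : ℕ} (hi : i ≤ n) {h u : S.U x → ℝ}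
    (H : h ∈ S.localHarmonic n x) (hu : S.IsLocalIterLap i h u) (w : S.W x) :
    ∃ d, S.HasTransverseDeriv w u d := by
  obtain ⟨k, rfl⟩ := Nat.exists_eq_add_of_le hi
  obtain ⟨v, hv, hv0⟩ := IsIterLap.split (i := i) (j := k + 1) (H.1 w)
  obtain rfl := (hu w).unique hv
  have h1 := hv0.smul ((S.rWord w.1 * S.wtWord w.1) ^ i)⁻¹
  rw [smul_smul, inv_mul_cancel₀ (rWord_mul_wtWord_pow_ne_zero w.1 i), one_smul, smul_zero] at h1
  obtain ⟨d, hd⟩ := exists_transverse_limit hlam (S.idx w) h1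
  refine ⟨_, (hd.const_mul (S.rWord w.1)⁻¹).congr fun m => ?_⟩
  rw [← mul_assoc]
  rfl

/-- A local multiharmonic function is determined by its jet at `x`. -/
theorem localHarmonic_eq_zero (hx : x ∈ S.Vstar) (hlam : S.lam ≠ 0) {n : ℕ} {h : S.U x → ℝ}
    (H : h ∈ S.localHarmonic n x)
    (hjet : ∀ i ≤ n, ∃ v, S.IsLocalIterLap i h v ∧ v (S.center x) = 0 ∧
      ∀ w, S.HasNormalDeriv w v 0 ∧ S.HasTransverseDeriv w v 0) : h = 0 := by
  refine ext_toU hx fun w z => ?_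
  refine congrFun (eq_zero_of_jet hlam (S.idx w) n (H.1 w) fun i hi => ?_) z
  obtain ⟨v, hv, h0, hd⟩ := hjet i hi
  have hvw := hv w
  generalize (S.rWord w.1 * S.wtWord w.1) ^ i = c at hvw
  have hr := (S.rWord_pos w.1).ne'
  refine ⟨_, hvw, ?_, ?_, ?_⟩
  · change c * v (S.toU w _) = 0
    rw [toU_idx, h0, mul_zero]
  · have h1 := (hasNormalDeriv_iff.1 (hd w).1).const_mul (c * S.rWord w.1)
    rw [mul_zero] at h1
    refine h1.congr fun m => ?_
    simp only [normalDiff, Pi.smul_apply, smul_eq_mul]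
    field_simp
  · have h1 := (hasTransverseDeriv_iff.1 (hd w).2).const_mul (c * S.rWord w.1)
    rw [mul_zero] at h1
    refine h1.congr fun m => ?_
    simp only [transverseDiff, Pi.smul_apply, smul_eq_mul]
    field_simp

theorem localHarmonic_ext (hx : x ∈ S.Vstar) (hlam : S.lam ≠ 0) {n : ℕ}
    {a b : S.localHarmonic n x}
    (hjet : ∀ i ≤ n, ∃ v v', S.IsLocalIterLap i a.1 v ∧ S.IsLocalIterLap i b.1 v' ∧
      v (S.center x) = v' (S.center x) ∧ ∀ w,
        (∃ d, S.HasNormalDeriv w v d ∧ S.HasNormalDeriv w v' d) ∧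
        ∃ d, S.HasTransverseDeriv w v d ∧ S.HasTransverseDeriv w v' d) : a = b := by
  have h1 : a.1 + (-1 : ℝ) • b.1 = 0 := by
    refine localHarmonic_eq_zero hx hlam (n := n) (a + (-1 : ℝ) • b).2 fun i hi => ?_
    obtain ⟨v, v', hv, hv', hc, hd⟩ := hjet i hi
    refine ⟨v + (-1 : ℝ) • v', hv.add (hv'.smul (-1)), ?_, fun w => ?_⟩
    · simp [hc]
    · obtain ⟨⟨d, h1, h2⟩, e, h3, h4⟩ := hd w
      have h5 := h1.add (h2.smul (-1))
      have h6 := h3.add (h4.smul (-1))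
      rw [neg_one_mul, add_neg_cancel] at h5 h6
      exact ⟨h5, h6⟩
  refine Subtype.ext ?_
  rwa [neg_one_smul, add_neg_eq_zero] at h1

variable (S) in
/-- `P` keeps the values, normal derivatives or transverse derivatives of `Δ^i h` at `x`
according to `k`, and makes the other two kinds of data zero. -/
def SelectsJet (n : ℕ) (x : K) (k : ℕ)
    (P : S.localHarmonic n x →ₗ[ℝ] S.localHarmonic n x) : Prop :=
  ∀ h : S.localHarmonic n x, ∀ i ≤ n, ∃ u v : S.U x → ℝ,
    S.IsLocalIterLap i h u ∧ S.IsLocalIterLap i (P h) v ∧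
    v (S.center x) = (if k = 1 then 1 else 0) * u (S.center x) ∧
    ∀ w : S.W x,
      (∃ d, S.HasNormalDeriv w u d ∧ S.HasNormalDeriv w v ((if k = 2 then 1 else 0) * d)) ∧
      (∃ d, S.HasTransverseDeriv w u d ∧
        S.HasTransverseDeriv w v ((if k = 3 then 1 else 0) * d))

theorem SelectsJet.unique (hx : x ∈ S.Vstar) (hlam : S.lam ≠ 0) {n k : ℕ}
    {P P' : S.localHarmonic n x →ₗ[ℝ] S.localHarmonic n x}
    (H : S.SelectsJet n x k P) (H' : S.SelectsJet n x k P') : P = P' := by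
  refine LinearMap.ext fun h => localHarmonic_ext hx hlam fun i hi => ?_
  obtain ⟨u, v, hu, hv, hc, hd⟩ := H h i hi
  obtain ⟨u', v', hu', hv', hc', hd'⟩ := H' h i hi
  obtain rfl := hu.unique hx hu'
  refine ⟨v, v', hv, hv', hc.trans hc'.symm, fun w => ?_⟩
  obtain ⟨⟨d, h1, h2⟩, e, h3, h4⟩ := hd w
  obtain ⟨⟨d', h1', h2'⟩, e', h3', h4'⟩ := hd' w
  obtain rfl := tendsto_nhds_unique h1 h1'
  obtain rfl := tendsto_nhds_unique h3 h3'
  exact ⟨⟨_, h2, h2'⟩, _, h4, h4'⟩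

/-- `P ∘ P` selects the same data as `P`, so idempotence is an instance of uniqueness. -/
theorem SelectsJet.isMonomialProjection (hx : x ∈ S.Vstar) (hlam : S.lam ≠ 0) {n k : ℕ}
    {P : S.localHarmonic n x →ₗ[ℝ] S.localHarmonic n x}
    (H : S.SelectsJet n x k P) : S.IsMonomialProjection n x k P := by
  refine ⟨SelectsJet.unique hx hlam (k := k) (fun h i hi => ?_) H, H⟩
  have hidem : ∀ (p : Prop) [Decidable p] (a : ℝ),
      (if p then (1 : ℝ) else 0) * ((if p then (1 : ℝ) else 0) * a) =
        (if p then (1 : ℝ) else 0) * a := fun p _ a => by split_ifs <;> simp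
  obtain ⟨u, v, hu, hv, hc, hd⟩ := H h i hi
  obtain ⟨u', v', hu', hv', hc', hd'⟩ := H (P h) i hi
  obtain rfl := hv.unique hx hu'
  refine ⟨u, v', hu, hv', by rw [hc', hc, hidem], fun w => ?_⟩
  obtain ⟨⟨d, h1, h2⟩, e, h3, h4⟩ := hd w
  obtain ⟨⟨d', h1', h2'⟩, e', h3', h4'⟩ := hd' w
  obtain rfl := tendsto_nhds_unique h2 h1'
  obtain rfl := tendsto_nhds_unique h4 h3'
  rw [hidem] at h2' h4'
  exact ⟨⟨d, h1, h2'⟩, e, h3, h4'⟩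

/-! ### The three explicit projections. -/

section Projections

variable {n : ℕ} {g : S.U x → S.U x} {R P : S.localHarmonic n x →ₗ[ℝ] S.localHarmonic n x}

/-- The derivatives at `x` of `h`, `R h` and their reflections. -/
theorem exists_jets (hx : x ∈ S.Vstar) (hlam : S.lam ≠ 0) (hg : S.IsLocalReflection x g)
    {A : (S.U x → ℝ) →ₗ[ℝ] (S.U x → ℝ)} (hA : S.IsAverage x A) {h : S.U x → ℝ}
    (H : h ∈ S.localHarmonic n x) {i : ℕ} (hi : i ≤ n) :
    ∃ u v : S.U x → ℝ, S.IsLocalIterLap i h u ∧ S.IsLocalIterLap i (A h) v ∧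
      S.IsLocalIterLap i (h ∘ g) (u ∘ g) ∧ S.IsLocalIterLap i (A h ∘ g) (v ∘ g) ∧
      v (S.center x) = u (S.center x) ∧ g (S.center x) = S.center x ∧
      ∀ w, ∃ d s t, S.HasNormalDeriv w u d ∧ S.HasNormalDeriv w (u ∘ g) d ∧
        S.HasNormalDeriv w v 0 ∧ S.HasNormalDeriv w (v ∘ g) 0 ∧
        S.HasTransverseDeriv w u s ∧ S.HasTransverseDeriv w (u ∘ g) (-s) ∧
        S.HasTransverseDeriv w v t ∧ S.HasTransverseDeriv w (v ∘ g) (-t) := by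
  obtain ⟨u, hu, hm⟩ := H.2 i hi
  obtain ⟨w₀, -⟩ := exists_toU hx (S.center x)
  have hAu := hA.isLocalIterLap hu
  refine ⟨u, A u, hu, hAu, hu.comp_refl hg, hAu.comp_refl hg, hA.center hx u,
    hg.center w₀, fun w => ?_⟩
  have h0 := hA.hasNormalDeriv hm w
  obtain ⟨d, hd, -⟩ := hm
  obtain ⟨s, hs⟩ := exists_hasTransverseDeriv hlam hi H hu w
  -- The size of `t` is irrelevant: it cancels against `-t` from the reflected average.
  obtain ⟨t, ht⟩ := exists_hasTransverseDeriv hlam hi (hA.mem H) hAu w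
  exact ⟨d w, s, t, hd w, (hd w).comp_refl hg, h0, h0.comp_refl hg, hs, hs.comp_refl hg, ht,
    ht.comp_refl hg⟩

variable (hx : x ∈ S.Vstar) (hlam : S.lam ≠ 0) (hg : S.IsLocalReflection x g)
  {A : (S.U x → ℝ) →ₗ[ℝ] (S.U x → ℝ)} (hA : S.IsAverage x A)
  (hR : ∀ h, (R h).1 = A h.1)

include hx hlam hg hA hR

theorem selectsJet_one (hP : ∀ h, (P h).1 = (1 / 2 : ℝ) • ((R h).1 ∘ g + (R h).1)) :
    S.SelectsJet n x 1 P := by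
  intro h i hi
  obtain ⟨u, v, hu, hv, -, hvg, hc, hgc, hd⟩ := exists_jets hx hlam hg hA h.2 hi
  refine ⟨u, (1 / 2 : ℝ) • (v ∘ g + v), hu, ?_, ?_, fun w => ?_⟩
  · rw [hP, hR]
    exact (hvg.add hv).smul _
  · simp only [Pi.smul_apply, Pi.add_apply, Function.comp_apply, hgc, hc, smul_eq_mul, if_true]
    ring
  · obtain ⟨d, s, t, h1, -, h3, h4, h5, -, h7, h8⟩ := hd w
    refine ⟨⟨d, h1, ?_⟩, s, h5, ?_⟩
    · convert (h4.add h3).smul (1 / 2) using 1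
      simp
    · convert (h8.add h7).smul (1 / 2) using 1
      simp

theorem selectsJet_two
    (hP : ∀ h, (P h).1 = (1 / 2 : ℝ) • (h.1 + h.1 ∘ g - (R h).1 ∘ g - (R h).1)) :
    S.SelectsJet n x 2 P := by
  intro h i hi
  obtain ⟨u, v, hu, hv, hug, hvg, hc, hgc, hd⟩ := exists_jets hx hlam hg hA h.2 hi
  -- Differences become sums with factor `-1`, so that additivity and homogeneity of the data
  -- suffice.
  have hform : ∀ a b c d : S.U x → ℝ, (1 / 2 : ℝ) • (a + b - c - d) =
      (1 / 2 : ℝ) • (a + b + (-1 : ℝ) • c + (-1 : ℝ) • d) := fun a b c d => by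
    rw [neg_one_smul, neg_one_smul, sub_eq_add_neg, sub_eq_add_neg]
  refine ⟨u, (1 / 2 : ℝ) • (u + u ∘ g + (-1 : ℝ) • (v ∘ g) + (-1 : ℝ) • v), hu, ?_, ?_,
    fun w => ?_⟩
  · rw [hP, hR, hform]
    exact (((hu.add hug).add (hvg.smul _)).add (hv.smul _)).smul _
  · simp only [Pi.smul_apply, Pi.add_apply, Function.comp_apply, hgc, hc, smul_eq_mul]
    norm_num
  · obtain ⟨d, s, t, h1, h2, h3, h4, h5, h6, h7, h8⟩ := hd w
    refine ⟨⟨d, h1, ?_⟩, s, h5, ?_⟩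
    · convert (((h1.add h2).add (h4.smul (-1))).add (h3.smul (-1))).smul (1 / 2) using 1
      norm_num
      ring
    · convert (((h5.add h6).add (h8.smul (-1))).add (h7.smul (-1))).smul (1 / 2) using 1
      norm_num

omit hR in
theorem selectsJet_three (hP : ∀ h, (P h).1 = (1 / 2 : ℝ) • (h.1 - h.1 ∘ g)) :
    S.SelectsJet n x 3 P := by
  intro h i hi
  obtain ⟨u, v, hu, -, hug, -, -, hgc, hd⟩ := exists_jets hx hlam hg hA h.2 hi
  refine ⟨u, (1 / 2 : ℝ) • (u + (-1 : ℝ) • (u ∘ g)), hu, ?_, ?_, fun w => ?_⟩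
  · rw [hP, sub_eq_add_neg, ← neg_one_smul ℝ]
    exact (hu.add (hug.smul _)).smul _
  · simp [hgc]
  · obtain ⟨d, s, t, h1, h2, -, -, h5, h6, -, -⟩ := hd w
    refine ⟨⟨d, h1, ?_⟩, s, h5, ?_⟩
    · convert (h1.add (h2.smul (-1))).smul (1 / 2) using 1
      simp
    · convert (h5.add (h6.smul (-1))).smul (1 / 2) using 1
      norm_num
      ring

end Projections

end D3Fractal

/-! ### The main theorem. -/

theorem theorem3p5 {K : Type*} [MetricSpace K] [CompactSpace K] [ConnectedSpace K]
    [MeasurableSpace K] [BorelSpace K] (S : D3Fractal K)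
    (hM : ∀ l : Fin 3, Function.Injective (S.M l))
    (n : ℕ) (x : K) (hx : x ∈ S.Vstar) (hx0 : x ∉ S.V 0)
    (hcell : ∀ w w' : S.W x, w ≠ w' → Set.range (S.Fw w.1) ∩ Set.range (S.Fw w'.1) = {x}) :
    (∃! g : S.U x → S.U x, S.IsLocalReflection x g) ∧
    (∃! R : S.localHarmonic n x →ₗ[ℝ] S.localHarmonic n x, S.IsRotationAverage n x R) ∧
    (∀ k ∈ ({1, 2, 3} : Finset ℕ),
      ∃! P : S.localHarmonic n x →ₗ[ℝ] S.localHarmonic n x, S.IsMonomialProjection n x k P) ∧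
    ∀ (g : S.U x → S.U x) (R P₁ P₂ P₃ : S.localHarmonic n x →ₗ[ℝ] S.localHarmonic n x),
      S.IsLocalReflection x g → S.IsRotationAverage n x R →
      S.IsMonomialProjection n x 1 P₁ → S.IsMonomialProjection n x 2 P₂ →
      S.IsMonomialProjection n x 3 P₃ →
      ∀ h : S.localHarmonic n x,
        (P₁ h).1 = (1 / 2 : ℝ) • ((R h).1 ∘ g + (R h).1) ∧
        (P₂ h).1 = (1 / 2 : ℝ) • (h.1 + h.1 ∘ g - (R h).1 ∘ g - (R h).1) ∧
        (P₃ h).1 = (1 / 2 : ℝ) • (h.1 - h.1 ∘ g) := by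
  have hlam := S.lam_ne_zero (hM 0)
  have hgu := D3Fractal.existsUnique_localReflection hx hcell
  obtain ⟨g₀, hg₀⟩ := hgu.exists
  obtain ⟨A, hA⟩ := D3Fractal.exists_isAverage hx hcell
  set R₀ : S.localHarmonic n x →ₗ[ℝ] S.localHarmonic n x := A.restrict fun _ h => hA.mem h
  have hR₀ : ∀ h, (R₀ h).1 = A h.1 := fun _ => rfl
  have hRu : ∀ R, S.IsRotationAverage n x R → R = R₀ := fun R hR =>
    LinearMap.ext fun h => Subtype.ext <| D3Fractal.ext_toU hx fun w z =>
      (hR h w z).trans (hA h.1 w z).symm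
  set G : S.localHarmonic n x →ₗ[ℝ] S.localHarmonic n x :=
    (LinearMap.funLeft ℝ ℝ g₀).restrict fun _ h => D3Fractal.comp_refl_mem hg₀ h
  have h₁ : S.SelectsJet n x 1 ((1 / 2 : ℝ) • (G ∘ₗ R₀ + R₀)) :=
    D3Fractal.selectsJet_one hx hlam hg₀ hA hR₀ fun _ => rfl
  have h₂ : S.SelectsJet n x 2 ((1 / 2 : ℝ) • (LinearMap.id + G - G ∘ₗ R₀ - R₀)) :=
    D3Fractal.selectsJet_two hx hlam hg₀ hA hR₀ fun _ => rfl
  have h₃ : S.SelectsJet n x 3 ((1 / 2 : ℝ) • (LinearMap.id - G)) :=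
    D3Fractal.selectsJet_three hx hlam hg₀ hA fun _ => rfl
  have hPu : ∀ {k P}, S.SelectsJet n x k P →
      ∃! P : S.localHarmonic n x →ₗ[ℝ] S.localHarmonic n x, S.IsMonomialProjection n x k P :=
    fun {k P} hP => ⟨P, hP.isMonomialProjection hx hlam, fun P' hP' => D3Fractal.SelectsJet.unique hx hlam hP'.2 hP⟩
  refine ⟨hgu, ⟨R₀, fun h w z => hA h.1 w z, hRu⟩, fun k hk => ?_, ?_⟩
  · simp only [Finset.mem_insert, Finset.mem_singleton] at hk
    rcases hk with rfl | rfl | rfl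
    exacts [hPu h₁, hPu h₂, hPu h₃]
  · intro g R P₁ P₂ P₃ hg hR hP₁ hP₂ hP₃ h
    -- By uniqueness the given maps are the constructed ones, for which the formulas hold by
    -- definition.
    obtain rfl := hgu.unique hg hg₀
    obtain rfl := hRu R hR
    obtain rfl := D3Fractal.SelectsJet.unique hx hlam hP₁.2 h₁
    obtain rfl := D3Fractal.SelectsJet.unique hx hlam hP₂.2 h₂
    obtain rfl := D3Fractal.SelectsJet.unique hx hlam hP₃.2 h₃
    exact ⟨rfl, rfl, rfl⟩
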